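/- **Fermi–Ulam model.** Let $d\in C^\infty(\mathbb R)$ with $d\ge c$ for some constant $c>0$. For $\varepsilon>0$ a particle of unit mass moves freely on $0\le x\le d(\varepsilon t)$ between impacts, with finitely many impacts in bounded time; its velocity $v$ becomes $-v$ at an impact with the fixed wall $x=0$ and $2\varepsilon d'(\varepsilon t)-v$ at an impact with the moving wall $x=d(\varepsilon t)$. Put $\tau=\varepsilon t$, $I=d(\tau)|v|/\pi$, and $\phi=\pi x/d(\tau)$ if $v>0$, $\phi=\pi(2-x/d(\tau))$ if $v\le 0$; $\phi$ is defined mod $2\pi$ and is lifted to a continuous function of $t$ along the motion. Between the walls the motion is governed by $$H=\frac{\pi^2I^2}{2d^2}-\varepsilon\frac{I d'}{d}f(\phi),$$ where $f$ is $2\pi$-periodic, $f(\phi)=\phi$ on $(0,\pi)$, $f(\phi)=\phi-2\pi$ on $(\pi,2\pi)$. Let $r,k$ be natural numbers, $r\ge1$; if $k\ge 2$, assume also that $d$ and each of its derivatives are bounded on $\mathbb R$. (i) There are functions $S_i(\hat I,\phi,\tau)$ and $\mathcal H_i(\hat I,\tau)$, $1\le i\le r-1$, that are $C^\infty$ in $(\hat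 I,\tau)$ for $\hat I>0$, with $S_i$ continuous and $2\pi$-periodic in $\phi$, differentiable in $\phi$ for $\phi\not\equiv\pi \pmod{2\pi}$, and of zero average over $\phi$, such that with $$S=\sum_{i=1}^{r-1}\varepsilon^{i-1}S_i,\qquad \mathcal H_{\Sigma,r}=\frac{\pi^2\hat I^2}{2d(\tau)^2}+\sum_{i=1}^{r-1}\varepsilon^i\mathcal H_i,$$ one has, for all $\hat I>0$, $\tau$ and $\phi\not\equiv\pi\pmod{2\pi}$, as $\varepsilon\to0^+$, $$H\Big(\hat I+\varepsilon\frac{\partial S}{\partial\phi},\phi,\tau,\varepsilon\Big)+\varepsilon^2\frac{\partial S}{\partial\tau}=\mathcal H_{\Sigma,r}(\hat I,\tau,\varepsilon)+O(\varepsilon^r).$$ (ii) Let $S_i,\mathcal H_i$ be any such functions, and let $a>0$, $b$, $T>0$. There are $\varepsilon_0>0$ and $C>0$ such that the following holds for all $0<\varepsilon<\varepsilon_0$, all $L\le T\varepsilon^{-k}$, every motion of the particle on $[0,L]$, and every $t_0\in[0,L]$ at which the particle is not at a wall and $a\le I(t_0)\le b$. At every time $t\in[t_0,L]$ at which the particle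 is not at a wall, the equation $I=\hat I+\varepsilon\,\partial S/\partial\phi(\hat I,\phi,\tau,\varepsilon)$ has exactly one solution $\hat I=\hat I(t)$ in $(I/2,2I)$, and $$|\hat I(t)-\hat I(t_0)|\le C\varepsilon^r.$$ Moreover, put $\hat\phi=\phi+\varepsilon\,\partial S/\partial\hat I(\hat I,\phi,\tau,\varepsilon)$ and let $(J,\psi)$ be the solution on $[t_0,L]$ of the integrable system $$\dot J=0,\qquad \dot\psi=\frac{\partial\mathcal H_{\Sigma,r}}{\partial \hat I}(J,\varepsilon t,\varepsilon),\qquad J(t_0)=\hat I(t_0),\quad \psi(t_0)=\hat\phi(t_0).$$ Then, at the same times $t$, $$|\hat\phi(t)-\psi(t)|\le C\varepsilon^{r-k}.$$ Impacts are allowed between $t_0$ and $t$. -/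

import Mathlib

open Set Filter Topology Asymptotics
open scoped Real ContDiff

namespace FermiUlam

noncomputable section

/-! ### The particle between a fixed wall `x = 0` and a moving wall `x = d (ε t)` -/

/-- The particle is at one of the two walls at time `t`. -/
def IsImpact (d : ℝ → ℝ) (ε : ℝ) (x : ℝ → ℝ) (t : ℝ) : Prop :=
  x t = 0 ∨ x t = d (ε * t)

/-- Position `x` and velocity `v` of the particle on the time interval `[0, L]`: free flight
separated by finitely many impacts. At an impact with the fixed wall the velocity changes sign, at
an impact with the moving wall (whose velocity is `ε * d' (ε t)`) it is reflected in the frame of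
the wall. The value of `v` at the very instant of an impact is irrelevant. -/
structure IsMotion (d : ℝ → ℝ) (ε L : ℝ) (x v : ℝ → ℝ) : Prop where
  continuousOn : ContinuousOn x (Icc 0 L)
  mem_walls : ∀ t ∈ Icc 0 L, x t ∈ Icc 0 (d (ε * t))
  finite_impacts : {t | t ∈ Icc 0 L ∧ IsImpact d ε x t}.Finite
  free_flight : ∀ s t : ℝ, 0 ≤ s → s ≤ t → t ≤ L → (∀ u ∈ Icc s t, ¬ IsImpact d ε x u) →
    v t = v s ∧ x t = x s + v s * (t - s)
  impact_fixed : ∀ t ∈ Ioo 0 L, x t = 0 → ∃ v₁ v₂ : ℝ,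
    (∀ᶠ s in 𝓝[<] t, v s = v₁) ∧ (∀ᶠ s in 𝓝[>] t, v s = v₂) ∧ v₂ = -v₁
  impact_moving : ∀ t ∈ Ioo 0 L, x t = d (ε * t) → ∃ v₁ v₂ : ℝ,
    (∀ᶠ s in 𝓝[<] t, v s = v₁) ∧ (∀ᶠ s in 𝓝[>] t, v s = v₂) ∧
      v₂ = 2 * (ε * deriv d (ε * t)) - v₁

/-- The action `I = d |v| / π`. -/
def action (d : ℝ → ℝ) (ε : ℝ) (v : ℝ → ℝ) (t : ℝ) : ℝ :=
  d (ε * t) * |v t| / π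

/-- The phase in `[0, 2π]`: `π x / d` on the way to the moving wall, `π (2 - x / d)` on the way
back. -/
def phase (d : ℝ → ℝ) (ε : ℝ) (x v : ℝ → ℝ) (t : ℝ) : ℝ :=
  if 0 < v t then π * (x t / d (ε * t)) else π * (2 - x t / d (ε * t))

/-- `Φ` is a continuous determination along the motion of the phase, which is defined mod `2π`. -/
def IsLiftedPhase (d : ℝ → ℝ) (ε L : ℝ) (x v Φ : ℝ → ℝ) : Prop :=
  ContinuousOn Φ (Icc 0 L) ∧
    ∀ t ∈ Icc 0 L, ∃ n : ℤ, Φ t = phase d ε x v t + 2 * π * n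

/-! ### The Hamiltonian in action-angle variables and its normal form -/

/-- The `2π`-periodic function equal to `φ` on `(0, π)` and to `φ - 2π` on `(π, 2π)`. -/
def sawtooth (φ : ℝ) : ℝ :=
  if toIcoMod Real.two_pi_pos 0 φ < π then toIcoMod Real.two_pi_pos 0 φ
  else toIcoMod Real.two_pi_pos 0 φ - 2 * π

/-- The unperturbed energy `E = π² I² / (2 d²)`. -/
def energy (d : ℝ → ℝ) (I τ : ℝ) : ℝ :=
  π ^ 2 * I ^ 2 / (2 * d τ ^ 2)

/-- The Hamiltonian `H = E - (I ḋ / d) f(φ)` between the walls, where `ḋ = ε d'(τ)`. -/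
def hamiltonian (d : ℝ → ℝ) (ε I φ τ : ℝ) : ℝ :=
  energy d I τ - I * (ε * deriv d τ) / d τ * sawtooth φ

/-- `S = S₁ + ε S₂ + … + ε ^ (r - 2) S_{r - 1}`; the arguments of `S i` are `Î, φ, τ`. -/
def genS (r : ℕ) (S : ℕ → ℝ → ℝ → ℝ → ℝ) (ε J φ τ : ℝ) : ℝ :=
  ∑ i ∈ Finset.Icc 1 (r - 1), ε ^ (i - 1) * S i J φ τ

/-- `𝓗_{Σ,r} = E + ε 𝓗₁ + … + ε ^ (r - 1) 𝓗_{r - 1}`; the arguments of `h i` are `Î, τ`. -/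
def sumH (d : ℝ → ℝ) (r : ℕ) (h : ℕ → ℝ → ℝ → ℝ) (ε J τ : ℝ) : ℝ :=
  energy d J τ + ∑ i ∈ Finset.Icc 1 (r - 1), ε ^ i * h i J τ

/-- The Hamiltonian transformed by the generating function `Î φ + ε S (Î, φ, τ, ε)`, as a function
of `Î, φ, τ`: since `τ = ε t`, it is `H (Î + ε ∂S/∂φ, φ, τ, ε) + ε² ∂S/∂τ`. -/
def newHamiltonian (d : ℝ → ℝ) (r : ℕ) (S : ℕ → ℝ → ℝ → ℝ → ℝ) (ε J φ τ : ℝ) : ℝ :=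
  hamiltonian d ε (J + ε * deriv (fun θ => genS r S ε J θ τ) φ) φ τ
    + ε ^ 2 * deriv (fun σ => genS r S ε J φ σ) τ

/-- The functions `S 1, …, S (r - 1)` and `h 1, …, h (r - 1)` bring the Hamiltonian to the normal
form `𝓗_{Σ,r}(Î, τ, ε) + O(ε ^ r)`: they are smooth in `(Î, τ)`, `Î > 0`; each `S i` is
`2π`-periodic, continuous with respect to `φ`, differentiable in `φ` off the jumps of `sawtooth`,
and has zero average over `φ`. (For fixed `Î, φ, τ` the difference below is a polynomial in `ε`,
so `O(ε ^ r)` says that its coefficients of order less than `r` vanish.) -/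
structure IsNormalForm (d : ℝ → ℝ) (r : ℕ) (S : ℕ → ℝ → ℝ → ℝ → ℝ) (h : ℕ → ℝ → ℝ → ℝ) :
    Prop where
  contDiffOn_S : ∀ i ∈ Finset.Icc 1 (r - 1), ∀ φ : ℝ,
    ContDiffOn ℝ ∞ (fun p : ℝ × ℝ => S i p.1 φ p.2) (Ioi 0 ×ˢ univ)
  contDiffOn_h : ∀ i ∈ Finset.Icc 1 (r - 1),
    ContDiffOn ℝ ∞ (fun p : ℝ × ℝ => h i p.1 p.2) (Ioi 0 ×ˢ univ)
  continuous_S : ∀ i ∈ Finset.Icc 1 (r - 1), ∀ J > 0, ∀ τ : ℝ, Continuous fun φ => S i J φ τ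
  periodic_S : ∀ i ∈ Finset.Icc 1 (r - 1), ∀ J > 0, ∀ τ : ℝ,
    Function.Periodic (fun φ => S i J φ τ) (2 * π)
  average_S : ∀ i ∈ Finset.Icc 1 (r - 1), ∀ J > 0, ∀ τ : ℝ, ∫ φ in (0)..(2 * π), S i J φ τ = 0
  differentiableAt_S : ∀ i ∈ Finset.Icc 1 (r - 1), ∀ J > 0, ∀ φ τ : ℝ,
    (∀ n : ℤ, φ ≠ π + 2 * π * n) → DifferentiableAt ℝ (fun θ => S i J θ τ) φ
  normal_form : ∀ J > 0, ∀ φ τ : ℝ, (∀ n : ℤ, φ ≠ π + 2 * π * n) →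
    (fun ε : ℝ => newHamiltonian d r S ε J φ τ - sumH d r h ε J τ) =O[𝓝[>] 0] fun ε => ε ^ r

/-! ### The improved variables -/

/-- `J` is the value of the improved action `Î` at action `I`, phase `φ` and slow time `τ`: the
solution of `I = Î + ε ∂S/∂φ (Î, φ, τ, ε)` on the branch close to `I` (the equation may have
spurious roots close to `Î = 0`, where `S` is singular). -/
def IsImprovedAction (r : ℕ) (S : ℕ → ℝ → ℝ → ℝ → ℝ) (ε τ φ I J : ℝ) : Prop :=
  J ∈ Ioo (I / 2) (2 * I) ∧ I = J + ε * deriv (fun θ => genS r S ε J θ τ) φ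

/-- The improved phase `φ̂ = φ + ε ∂S/∂Î (Î, φ, τ, ε)`. -/
def improvedPhase (r : ℕ) (S : ℕ → ℝ → ℝ → ℝ → ℝ) (ε τ J φ : ℝ) : ℝ :=
  φ + ε * deriv (fun K => genS r S ε K φ τ) J

/-- `(J, ψ)` solves on `[t₀, t₁]` the integrable Hamiltonian system with Hamiltonian
`𝓗_{Σ,r} (J, ε t, ε)`, which does not depend on the phase `ψ`. -/
def IsIntegrableSolution (d : ℝ → ℝ) (r : ℕ) (h : ℕ → ℝ → ℝ → ℝ) (ε t₀ t₁ : ℝ)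
    (J ψ : ℝ → ℝ) : Prop :=
  ∀ t ∈ Icc t₀ t₁, HasDerivWithinAt J 0 (Icc t₀ t₁) t ∧
    HasDerivWithinAt ψ (deriv (fun K => sumH d r h ε K (ε * t)) (J t)) (Icc t₀ t₁) t

end

end FermiUlam

/-!
The improved action of a normal form of order `r` is an adiabatic invariant of the Fermi–Ulam model
with error `O(ε ^ r)`, over times `ε ^ (-k)` for any `k`. Two facts make this possible although the
Hamiltonian is discontinuous in the phase: between impacts the motion is a Hamiltonian flow to which
the usual perturbation theory applies, and at an impact the improved variables do not jump.

*The normal form.* The Hamiltonian is homogeneous, so with `z = ε / Î` and the phase `x` in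
`[-π, π]` everything becomes a polynomial in `z` and `x` whose coefficients are polynomials in
`1 / d` and the derivatives of `d` (the class `PolyFun`). The recursion `stage` solves one
homological equation per order: `corrHam` is the average of the leading coefficient of the
remainder and `corrGen` a primitive of what is left. The identity `stage_identity` says that the
remainder at stage `n` is of order `z ^ (n + 1)`; composed with the sawtooth function it gives the
existence of the normal form (`isNormalForm_canon`). If two normal forms agree below some order,
their next terms differ by a function which is piecewise affine in the phase; continuity,
periodicity and zero average make it vanish. Hence the normal form is unique
(`IsNormalForm.eq_of_isNormalForm`), and only the constructed one has to be considered.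

*Impacts.* By `stage_jump` the phase derivative of the generating function jumps by
`2 d d' / π` between `x = -π` and `x = π`, and this jump comes from the first stage only. Multiplied
by `ε` it is exactly `d / π` times the loss `2 ε d'` of speed at the moving wall, so the equation
`I = Î + ε ∂S/∂φ` keeps its solution `Î` through an impact (`action_eq_of_impact`).

*Flights.* Differentiating `stage_identity` in `x` and in `z` shows that, with `Î` frozen, the
defect of the equation for the improved action and the error of the improved phase have time
derivatives of order `ε ^ (n + 1)` along the free motion, up to a multiple of the defect itself; in
the equation for the defect this multiple has a factor `ε`. A flight takes a bounded time, so the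
feedback is harmless (`exists_drift`, `exists_flight`). Induction on the number of impacts
adds up the drifts of the flights to `O(ε ^ (n + 1))` per unit of time (`exists_chain`).

*Long times.* Over the time `ε ^ (-k)` this is applied to the normal form of order `r + k + 1`,
whose improved action varies by only `O(ε ^ (r + 1))`. The improved variables of order `r` differ
from those of order `r + k + 1` by `O(ε ^ r)` (`exists_compare`), and the frequencies differ by
`O(ε ^ r)` (`exists_compare_freq`), which integrates to `O(ε ^ (r - k))`.
-/

namespace FermiUlam

noncomputable section

/-! ### Polynomials in the small parameter and the phase with coefficients built from `d` -/

/-- The algebra of functions of the slow time generated by `1 / d` and all derivatives of `d`. -/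
def coeffAlgebra (d : ℝ → ℝ) : Subalgebra ℝ (ℝ → ℝ) :=
  Algebra.adjoin ℝ (insert (fun τ => (d τ)⁻¹) (range fun n => iteratedDeriv n d))

theorem inv_mem_coeffAlgebra (d : ℝ → ℝ) : (fun τ => (d τ)⁻¹) ∈ coeffAlgebra d :=
  Algebra.subset_adjoin (mem_insert _ _)

theorem iteratedDeriv_mem_coeffAlgebra (d : ℝ → ℝ) (n : ℕ) :
    iteratedDeriv n d ∈ coeffAlgebra d :=
  Algebra.subset_adjoin (mem_insert_of_mem _ (mem_range_self n))

theorem const_mem_coeffAlgebra (d : ℝ → ℝ) (a : ℝ) : (fun _ => a) ∈ coeffAlgebra d :=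
  (coeffAlgebra d).algebraMap_mem a

theorem self_mem_coeffAlgebra (d : ℝ → ℝ) : d ∈ coeffAlgebra d := by
  simpa using iteratedDeriv_mem_coeffAlgebra d 0

theorem deriv_self_mem_coeffAlgebra (d : ℝ → ℝ) : deriv d ∈ coeffAlgebra d := by
  simpa using iteratedDeriv_mem_coeffAlgebra d 1

theorem contDiff_of_mem_coeffAlgebra {d : ℝ → ℝ} (hd : ContDiff ℝ ∞ d) (hd0 : ∀ τ, d τ ≠ 0)
    {c : ℝ → ℝ} (hc : c ∈ coeffAlgebra d) : ContDiff ℝ ∞ c := by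
  induction hc using Algebra.adjoin_induction with
  | mem x hx =>
    rcases hx with rfl | ⟨n, rfl⟩
    · exact hd.inv hd0
    · simp only [iteratedDeriv_eq_iterate]
      exact hd.iterate_deriv n
  | algebraMap r => exact contDiff_const
  | add x y _ _ hx hy => exact hx.add hy
  | mul x y _ _ hx hy => exact hx.mul hy

theorem deriv_mem_coeffAlgebra {d : ℝ → ℝ} (hd : ContDiff ℝ ∞ d) (hd0 : ∀ τ, d τ ≠ 0)
    {c : ℝ → ℝ} (hc : c ∈ coeffAlgebra d) : deriv c ∈ coeffAlgebra d := by
  induction hc using Algebra.adjoin_induction with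
  | mem x hx =>
    rcases hx with rfl | ⟨n, rfl⟩
    · have : deriv (fun τ => (d τ)⁻¹)
          = (-1 : ℝ) • (deriv d * ((fun τ => (d τ)⁻¹) * fun τ => (d τ)⁻¹)) := by
        ext τ
        have h := ((hd.differentiable (by simp)) τ).hasDerivAt.inv (hd0 τ)
        have h' : HasDerivAt (fun τ => (d τ)⁻¹) (-deriv d τ / d τ ^ 2) τ := h
        rw [h'.deriv]
        simp only [Pi.smul_apply, Pi.mul_apply, smul_eq_mul]
        field_simp [hd0 τ]
      rw [this]
      exact Subalgebra.smul_mem _ (Subalgebra.mul_mem _ (deriv_self_mem_coeffAlgebra d)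
        (Subalgebra.mul_mem _ (inv_mem_coeffAlgebra d) (inv_mem_coeffAlgebra d))) _
    · simp only [← iteratedDeriv_succ]
      exact iteratedDeriv_mem_coeffAlgebra d (n + 1)
  | algebraMap r =>
    have : deriv (algebraMap ℝ (ℝ → ℝ) r) = fun _ => (0 : ℝ) := by
      ext τ
      exact deriv_const τ r
    rw [this]
    exact const_mem_coeffAlgebra d 0
  | add x y hx' hy' hx hy =>
    have : deriv (x + y) = deriv x + deriv y := by
      ext τ
      exact deriv_add ((contDiff_of_mem_coeffAlgebra hd hd0 hx').differentiable (by simp) τ)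
        ((contDiff_of_mem_coeffAlgebra hd hd0 hy').differentiable (by simp) τ)
    rw [this]
    exact Subalgebra.add_mem _ hx hy
  | mul x y hx' hy' hx hy =>
    have : deriv (x * y) = deriv x * y + x * deriv y := by
      ext τ
      exact deriv_mul ((contDiff_of_mem_coeffAlgebra hd hd0 hx').differentiable (by simp) τ)
        ((contDiff_of_mem_coeffAlgebra hd hd0 hy').differentiable (by simp) τ)
    rw [this]
    exact Subalgebra.add_mem _ (Subalgebra.mul_mem _ hx hy') (Subalgebra.mul_mem _ hx' hy)

theorem bounded_of_mem_coeffAlgebra {d : ℝ → ℝ} {c₀ : ℝ} (hc₀ : 0 < c₀) (hdc : ∀ τ, c₀ ≤ d τ)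
    {U : Set ℝ} (hU : ∀ n : ℕ, ∃ M : ℝ, ∀ τ ∈ U, |iteratedDeriv n d τ| ≤ M)
    {c : ℝ → ℝ} (hc : c ∈ coeffAlgebra d) : ∃ M : ℝ, ∀ τ ∈ U, |c τ| ≤ M := by
  induction hc using Algebra.adjoin_induction with
  | mem x hx =>
    rcases hx with rfl | ⟨n, rfl⟩
    · refine ⟨c₀⁻¹, fun τ _ => ?_⟩
      have h := hdc τ
      rw [abs_of_pos (inv_pos.2 (hc₀.trans_le h))]
      exact inv_anti₀ hc₀ h
    · exact hU n
  | algebraMap r => exact ⟨|r|, fun τ _ => le_rfl⟩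
  | add x y _ _ hx hy =>
    obtain ⟨M, hM⟩ := hx
    obtain ⟨N, hN⟩ := hy
    exact ⟨M + N, fun τ h => (abs_add_le _ _).trans (add_le_add (hM τ h) (hN τ h))⟩
  | mul x y _ _ hx hy =>
    obtain ⟨M, hM⟩ := hx
    obtain ⟨N, hN⟩ := hy
    refine ⟨M * N, fun τ h => ?_⟩
    rw [Pi.mul_apply, abs_mul]
    exact mul_le_mul (hM τ h) (hN τ h) (abs_nonneg _) ((abs_nonneg _).trans (hM τ h))

/-- Finite sums of `c(τ) x ^ i z ^ j` with `c` in `coeffAlgebra d`, as functions of `z`, `x`, `τ`.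
Here `z` stands for `ε / Î` and `x` for the phase in `[-π, π]`. -/
inductive PolyFun (d : ℝ → ℝ) : (ℝ → ℝ → ℝ → ℝ) → Prop
  | mono (c : ℝ → ℝ) (hc : c ∈ coeffAlgebra d) (i j : ℕ) :
      PolyFun d (fun z x τ => c τ * x ^ i * z ^ j)
  | add (F G : ℝ → ℝ → ℝ → ℝ) (hF : PolyFun d F) (hG : PolyFun d G) :
      PolyFun d (fun z x τ => F z x τ + G z x τ)

/-- The partial derivative in `z`. -/
def dz (F : ℝ → ℝ → ℝ → ℝ) (z x τ : ℝ) : ℝ := deriv (fun y => F y x τ) z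

/-- The partial derivative in `x`. -/
def dx (F : ℝ → ℝ → ℝ → ℝ) (z x τ : ℝ) : ℝ := deriv (fun y => F z y τ) x

/-- The partial derivative in `τ`. -/
def dt (F : ℝ → ℝ → ℝ → ℝ) (z x τ : ℝ) : ℝ := deriv (fun y => F z x y) τ

/-- The difference quotient `(F(z) - F(0)) / z`. -/
def divZ (F : ℝ → ℝ → ℝ → ℝ) (z x τ : ℝ) : ℝ := dslope (fun y => F y x τ) 0 z

namespace PolyFun

variable {d : ℝ → ℝ} {F G : ℝ → ℝ → ℝ → ℝ}

theorem coeff {c : ℝ → ℝ} (hc : c ∈ coeffAlgebra d) : PolyFun d (fun _ _ τ => c τ) := by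
  simpa using mono c hc 0 0

theorem const (a : ℝ) : PolyFun d (fun _ _ _ => a) := coeff (const_mem_coeffAlgebra d a)

theorem x_var : PolyFun d (fun _ x _ => x) := by
  simpa using mono _ (const_mem_coeffAlgebra d 1) 1 0

theorem z_var : PolyFun d (fun z _ _ => z) := by
  simpa using mono _ (const_mem_coeffAlgebra d 1) 0 1

theorem mul (hF : PolyFun d F) (hG : PolyFun d G) :
    PolyFun d (fun z x τ => F z x τ * G z x τ) := by
  induction hF with
  | mono c hc i j =>
    induction hG with
    | mono c' hc' i' j' =>
      convert mono (c * c') (Subalgebra.mul_mem _ hc hc') (i + i') (j + j') using 4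
      simp only [Pi.mul_apply]
      ring
    | add F G _ _ hF hG => simpa only [mul_add] using hF.add _ _ hG
  | add F G _ _ hF hG => simpa only [add_mul] using hF.add _ _ hG

theorem neg (hF : PolyFun d F) : PolyFun d (fun z x τ => -F z x τ) := by
  simpa using (const (-1)).mul hF

theorem sub (hF : PolyFun d F) (hG : PolyFun d G) :
    PolyFun d (fun z x τ => F z x τ - G z x τ) := by
  simpa only [sub_eq_add_neg] using hF.add _ _ hG.neg

theorem pow (hF : PolyFun d F) (n : ℕ) : PolyFun d (fun z x τ => F z x τ ^ n) := by
  induction n with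
  | zero => simpa using const 1
  | succ n ih => simpa only [pow_succ] using ih.mul hF

theorem hasDerivAt_z (hF : PolyFun d F) (z x τ : ℝ) :
    HasDerivAt (fun y => F y x τ) (FermiUlam.dz F z x τ) z := by
  refine DifferentiableAt.hasDerivAt ?_
  induction hF with
  | mono c hc i j => fun_prop
  | add F G _ _ hF hG => exact hF.add hG

theorem hasDerivAt_x (hF : PolyFun d F) (z x τ : ℝ) :
    HasDerivAt (fun y => F z y τ) (FermiUlam.dx F z x τ) x := by
  refine DifferentiableAt.hasDerivAt ?_
  induction hF with
  | mono c hc i j => fun_prop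
  | add F G _ _ hF hG => exact hF.add hG

theorem dz_mono (c : ℝ → ℝ) (i j : ℕ) :
    FermiUlam.dz (fun z x τ => c τ * x ^ i * z ^ j)
      = fun z x τ => (j * c τ) * x ^ i * z ^ (j - 1) := by
  ext z x τ
  have := ((hasDerivAt_pow j z).const_mul (c τ * x ^ i)).deriv
  rw [FermiUlam.dz, this]
  ring

theorem dx_mono (c : ℝ → ℝ) (i j : ℕ) :
    FermiUlam.dx (fun z x τ => c τ * x ^ i * z ^ j)
      = fun z x τ => (i * c τ) * x ^ (i - 1) * z ^ j := by
  ext z x τ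
  have := (((hasDerivAt_pow i x).const_mul (c τ)).mul_const (z ^ j)).deriv
  rw [FermiUlam.dx, this]
  ring

theorem dt_mono (c : ℝ → ℝ) (i j : ℕ) :
    FermiUlam.dt (fun z x τ => c τ * x ^ i * z ^ j)
      = fun z x τ => deriv c τ * x ^ i * z ^ j := by
  ext z x τ
  simp only [FermiUlam.dt, deriv_mul_const_field]

theorem dz_add (hF : PolyFun d F) (hG : PolyFun d G) :
    FermiUlam.dz (fun z x τ => F z x τ + G z x τ)
      = fun z x τ => FermiUlam.dz F z x τ + FermiUlam.dz G z x τ := by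
  ext z x τ
  exact ((hF.hasDerivAt_z z x τ).add (hG.hasDerivAt_z z x τ)).deriv

theorem dx_add (hF : PolyFun d F) (hG : PolyFun d G) :
    FermiUlam.dx (fun z x τ => F z x τ + G z x τ)
      = fun z x τ => FermiUlam.dx F z x τ + FermiUlam.dx G z x τ := by
  ext z x τ
  exact ((hF.hasDerivAt_x z x τ).add (hG.hasDerivAt_x z x τ)).deriv

theorem dz (hF : PolyFun d F) : PolyFun d (dz F) := by
  induction hF with
  | mono c hc i j =>
    rw [dz_mono]
    exact mono (fun τ => j * c τ)
      (Subalgebra.mul_mem _ (const_mem_coeffAlgebra d j) hc) i (j - 1)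
  | add F G hF' hG' hF hG =>
    rw [dz_add hF' hG']
    exact hF.add _ _ hG

theorem dx (hF : PolyFun d F) : PolyFun d (dx F) := by
  induction hF with
  | mono c hc i j =>
    rw [dx_mono]
    exact mono (fun τ => i * c τ)
      (Subalgebra.mul_mem _ (const_mem_coeffAlgebra d i) hc) (i - 1) j
  | add F G hF' hG' hF hG =>
    rw [dx_add hF' hG']
    exact hF.add _ _ hG

theorem dz_dx (hF : PolyFun d F) :
    FermiUlam.dz (FermiUlam.dx F) = FermiUlam.dx (FermiUlam.dz F) := by
  induction hF with
  | mono c hc i j =>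
    rw [dx_mono, dz_mono (fun τ => i * c τ), dz_mono, dx_mono (fun τ => j * c τ)]
    ext z x τ
    ring
  | add F G hF' hG' hF hG =>
    rw [dx_add hF' hG', dz_add hF' hG', dz_add hF'.dx hG'.dx, dx_add hF'.dz hG'.dz, hF, hG]

theorem continuous_z (hF : PolyFun d F) (x τ : ℝ) : Continuous fun z => F z x τ :=
  continuous_iff_continuousAt.2 fun z => (hF.hasDerivAt_z z x τ).continuousAt

theorem continuous_x (hF : PolyFun d F) (z τ : ℝ) : Continuous fun x => F z x τ :=
  continuous_iff_continuousAt.2 fun x => (hF.hasDerivAt_x z x τ).continuousAt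

theorem comp_x (hF : PolyFun d F) (a : ℝ) : PolyFun d (fun z _ τ => F z a τ) := by
  induction hF with
  | mono c hc i j =>
    simpa using mono (fun τ => c τ * a ^ i)
      (Subalgebra.mul_mem _ hc (const_mem_coeffAlgebra d (a ^ i))) 0 j
  | add F G _ _ hF hG => exact hF.add _ _ hG

theorem comp_z (hF : PolyFun d F) (a : ℝ) : PolyFun d (fun _ x τ => F a x τ) := by
  induction hF with
  | mono c hc i j =>
    convert mono (fun τ => c τ * a ^ j)
      (Subalgebra.mul_mem _ hc (const_mem_coeffAlgebra d (a ^ j))) i 0 using 4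
    ring
  | add F G _ _ hF hG => exact hF.add _ _ hG

theorem primitive (hF : PolyFun d F) : PolyFun d (fun z x τ => ∫ y in (0)..x, F z y τ) := by
  induction hF with
  | mono c hc i j =>
    convert mono (fun τ => c τ * ((i : ℝ) + 1)⁻¹)
      (Subalgebra.mul_mem _ hc (const_mem_coeffAlgebra d _)) (i + 1) j using 4 with z x τ
    rw [intervalIntegral.integral_mul_const, intervalIntegral.integral_const_mul, integral_pow,
      zero_pow (Nat.succ_ne_zero i), sub_zero]
    ring
  | add F G hF' hG' hF hG =>
    convert hF.add _ _ hG using 4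
    exact intervalIntegral.integral_add ((hF'.continuous_x _ _).intervalIntegrable _ _)
      ((hG'.continuous_x _ _).intervalIntegrable _ _)

theorem integral (hF : PolyFun d F) (a b : ℝ) :
    PolyFun d (fun z _ τ => ∫ y in a..b, F z y τ) := by
  convert (hF.primitive.comp_x b).sub (hF.primitive.comp_x a) using 4
  exact (intervalIntegral.integral_interval_sub_left
    ((hF.continuous_x _ _).intervalIntegrable _ _)
    ((hF.continuous_x _ _).intervalIntegrable _ _)).symm

theorem mul_divZ (z x τ : ℝ) : z * divZ F z x τ = F z x τ - F 0 x τ := by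
  simpa [FermiUlam.divZ] using sub_smul_dslope (fun y => F y x τ) 0 z

theorem divZ (hF : PolyFun d F) : PolyFun d (divZ F) := by
  induction hF with
  | mono c hc i j =>
    cases j with
    | zero =>
      convert const 0 using 4 with z x τ
      rw [FermiUlam.divZ]
      rcases eq_or_ne z 0 with rfl | h
      · simp
      · rw [dslope_of_ne _ h, slope_def_field]
        simp
    | succ j =>
      convert mono c hc i j using 4 with z x τ
      rw [FermiUlam.divZ]
      rcases eq_or_ne z 0 with rfl | h
      · have := ((hasDerivAt_pow (j + 1) (0 : ℝ)).const_mul (c τ * x ^ i)).deriv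
        rw [dslope_same, this]
        cases j <;> simp
      · rw [dslope_of_ne _ h, slope_def_field]
        field_simp
        ring
  | add F G hF' hG' hF hG =>
    convert hF.add _ _ hG using 4 with z x τ
    simp only [FermiUlam.divZ]
    rcases eq_or_ne z 0 with rfl | h
    · simp only [dslope_same]
      exact ((hF'.hasDerivAt_z 0 x τ).add (hG'.hasDerivAt_z 0 x τ)).deriv
    · simp only [dslope_of_ne _ h, slope_def_field]
      ring

/-- An element of the class is bounded for `z ∈ [-1, 1]`, `x ∈ [-π, π]` and `τ` in a set on which
all derivatives of `d` are bounded. -/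
theorem bounded (hF : PolyFun d F) {c₀ : ℝ} (hc₀ : 0 < c₀) (hdc : ∀ τ, c₀ ≤ d τ)
    {U : Set ℝ} (hU : ∀ n : ℕ, ∃ M : ℝ, ∀ τ ∈ U, |iteratedDeriv n d τ| ≤ M) :
    ∃ M : ℝ, ∀ τ ∈ U, ∀ x z : ℝ, |x| ≤ π → |z| ≤ 1 → |F z x τ| ≤ M := by
  induction hF with
  | mono c hc i j =>
    obtain ⟨M, hM⟩ := bounded_of_mem_coeffAlgebra hc₀ hdc hU hc
    refine ⟨M * π ^ i * 1 ^ j, fun τ hτ x z hx hz => ?_⟩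
    rw [abs_mul, abs_mul, abs_pow, abs_pow]
    have := (abs_nonneg _).trans (hM τ hτ)
    gcongr
    exact hM τ hτ
  | add F G _ _ hF hG =>
    obtain ⟨M, hM⟩ := hF
    obtain ⟨N, hN⟩ := hG
    exact ⟨M + N, fun τ hτ x z hx hz =>
      (abs_add_le _ _).trans (add_le_add (hM τ hτ x z hx hz) (hN τ hτ x z hx hz))⟩

section smooth

variable (hd : ContDiff ℝ ∞ d) (hd0 : ∀ τ, d τ ≠ 0)
include hd hd0

theorem contDiff_t (hF : PolyFun d F) (z x : ℝ) : ContDiff ℝ ∞ (fun τ => F z x τ) := by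
  induction hF with
  | mono c hc i j =>
    have := contDiff_of_mem_coeffAlgebra hd hd0 hc
    fun_prop
  | add F G _ _ hF hG => exact hF.add hG

theorem hasDerivAt_t (hF : PolyFun d F) (z x τ : ℝ) :
    HasDerivAt (fun y => F z x y) (FermiUlam.dt F z x τ) τ :=
  ((hF.contDiff_t hd hd0 z x).differentiable (by simp) τ).hasDerivAt

theorem dt_add (hF : PolyFun d F) (hG : PolyFun d G) :
    FermiUlam.dt (fun z x τ => F z x τ + G z x τ)
      = fun z x τ => FermiUlam.dt F z x τ + FermiUlam.dt G z x τ := by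
  ext z x τ
  exact ((hF.hasDerivAt_t hd hd0 z x τ).add (hG.hasDerivAt_t hd hd0 z x τ)).deriv

theorem dt (hF : PolyFun d F) : PolyFun d (dt F) := by
  induction hF with
  | mono c hc i j =>
    rw [dt_mono]
    exact mono _ (deriv_mem_coeffAlgebra hd hd0 hc) i j
  | add F G hF' hG' hF hG =>
    rw [dt_add hd hd0 hF' hG']
    exact hF.add _ _ hG

theorem dt_dx (hF : PolyFun d F) :
    FermiUlam.dt (FermiUlam.dx F) = FermiUlam.dx (FermiUlam.dt F) := by
  induction hF with
  | mono c hc i j =>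
    rw [dx_mono, dt_mono (fun τ => i * c τ), dt_mono, dx_mono]
    ext z x τ
    rw [deriv_const_mul_field]
  | add F G hF' hG' hF hG =>
    rw [dx_add hF' hG', dt_add hd hd0 hF' hG', dt_add hd hd0 hF'.dx hG'.dx,
      dx_add (hF'.dt hd hd0) (hG'.dt hd hd0), hF, hG]

theorem dt_dz (hF : PolyFun d F) :
    FermiUlam.dt (FermiUlam.dz F) = FermiUlam.dz (FermiUlam.dt F) := by
  induction hF with
  | mono c hc i j =>
    rw [dz_mono, dt_mono (fun τ => j * c τ), dt_mono, dz_mono]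
    ext z x τ
    rw [deriv_const_mul_field]
  | add F G hF' hG' hF hG =>
    rw [dz_add hF' hG', dt_add hd hd0 hF' hG', dt_add hd hd0 hF'.dz hG'.dz,
      dz_add (hF'.dt hd hd0) (hG'.dt hd hd0), hF, hG]

/-- The chain rule along a curve in the `(x, τ)` plane. -/
theorem hasDerivAt_comp (hF : PolyFun d F) (z : ℝ) {X Y : ℝ → ℝ} {X' Y' u : ℝ}
    (hX : HasDerivAt X X' u) (hY : HasDerivAt Y Y' u) :
    HasDerivAt (fun t => F z (X t) (Y t))
      (FermiUlam.dx F z (X u) (Y u) * X' + FermiUlam.dt F z (X u) (Y u) * Y') u := by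
  induction hF with
  | mono c hc i j =>
    have hc' := ((contDiff_of_mem_coeffAlgebra hd hd0 hc).differentiable (by simp) (Y u)).hasDerivAt
    have := ((hc'.comp u hY).mul (hX.pow i)).mul_const (z ^ j)
    rw [dx_mono, dt_mono]
    refine HasDerivAt.congr_deriv this ?_
    simp only [Function.comp_apply, Pi.pow_apply]
    ring
  | add F G hF' hG' hF hG =>
    rw [dx_add hF' hG', dt_add hd hd0 hF' hG']
    exact (hF.add hG).congr_deriv (by ring)

end smooth

end PolyFun

/-! ### The sawtooth function -/

/-- At `φ = π` the value `π - 2π = -π` is the one prescribed by the definition of `sawtooth`. -/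
theorem sawtooth_eq_toIcoMod (φ : ℝ) : sawtooth φ = toIcoMod Real.two_pi_pos (-π) φ := by
  symm
  rw [toIcoMod_eq_iff]
  have hm := toIcoMod_mem_Ico Real.two_pi_pos 0 φ
  have hz : φ = toIcoMod Real.two_pi_pos 0 φ + toIcoDiv Real.two_pi_pos 0 φ • (2 * π) :=
    (toIcoMod_add_toIcoDiv_zsmul _ _ _).symm
  rw [zero_add] at hm
  have hπ := Real.pi_pos
  unfold sawtooth
  split_ifs with h
  · exact ⟨⟨by linarith [hm.1], by linarith⟩, _, hz⟩
  · refine ⟨⟨by linarith, by linarith [hm.2]⟩, toIcoDiv Real.two_pi_pos 0 φ + 1, ?_⟩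
    rw [add_smul, one_smul]
    linarith

theorem sawtooth_mem (φ : ℝ) : sawtooth φ ∈ Ico (-π) π := by
  have := toIcoMod_mem_Ico Real.two_pi_pos (-π) φ
  rw [← sawtooth_eq_toIcoMod] at this
  exact ⟨this.1, by linarith [this.2]⟩

theorem abs_sawtooth_le (φ : ℝ) : |sawtooth φ| ≤ π :=
  abs_le.2 ⟨(sawtooth_mem φ).1, (sawtooth_mem φ).2.le⟩

theorem exists_eq_sawtooth_add (φ : ℝ) : ∃ n : ℤ, φ = sawtooth φ + 2 * π * n := by
  refine ⟨toIcoDiv Real.two_pi_pos (-π) φ, ?_⟩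
  have := toIcoMod_add_toIcoDiv_zsmul Real.two_pi_pos (-π) φ
  rw [← sawtooth_eq_toIcoMod, zsmul_eq_mul] at this
  linarith

theorem sawtooth_eq_of_eq_add {φ x : ℝ} (hx : x ∈ Ico (-π) π) {n : ℤ} (h : φ = x + 2 * π * n) :
    sawtooth φ = x := by
  rw [sawtooth_eq_toIcoMod, toIcoMod_eq_iff]
  refine ⟨⟨hx.1, by linarith [hx.2]⟩, n, ?_⟩
  rw [zsmul_eq_mul, h]
  ring

theorem sawtooth_eq_self {x : ℝ} (hx : x ∈ Ico (-π) π) : sawtooth x = x :=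
  sawtooth_eq_of_eq_add hx (n := 0) (by simp)

theorem sawtooth_periodic : Function.Periodic sawtooth (2 * π) := by
  intro φ
  obtain ⟨n, hn⟩ := exists_eq_sawtooth_add φ
  refine sawtooth_eq_of_eq_add (sawtooth_mem φ) (n := n + 1) ?_
  push_cast
  linarith

theorem hasDerivAt_sawtooth {φ : ℝ} (hφ : ∀ n : ℤ, φ ≠ π + 2 * π * n) :
    HasDerivAt sawtooth 1 φ := by
  obtain ⟨n, hn⟩ := exists_eq_sawtooth_add φ
  have hm := sawtooth_mem φ
  have h1 : -π < sawtooth φ := by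
    refine lt_of_le_of_ne hm.1 fun h => hφ (n - 1) ?_
    push_cast
    linarith
  have hev : ∀ᶠ θ in 𝓝 φ, sawtooth θ = θ - 2 * π * n := by
    have ho : Ioo (-π + 2 * π * n) (π + 2 * π * n) ∈ 𝓝 φ :=
      Ioo_mem_nhds (by linarith) (by linarith [hm.2])
    filter_upwards [ho] with θ hθ
    exact sawtooth_eq_of_eq_add (n := n) ⟨by linarith [hθ.1], by linarith [hθ.2]⟩ (by ring)
  exact ((hasDerivAt_id φ).sub_const (2 * π * n)).congr_of_eventuallyEq hev

/-- A continuous function with equal values at `-π` and `π` stays continuous when it is extended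
periodically. -/
theorem continuous_comp_sawtooth {F : ℝ → ℝ} (hF : Continuous F) (h : F π = F (-π)) :
    Continuous fun φ => F (sawtooth φ) := by
  have : Fact (0 < 2 * π) := ⟨Real.two_pi_pos⟩
  have hc : Continuous (AddCircle.liftIco (2 * π) (-π) F) :=
    AddCircle.liftIco_continuous (by rw [← h]; congr 1; ring) hF.continuousOn
  refine (hc.comp (AddCircle.continuous_mk' (2 * π))).congr fun φ => ?_
  obtain ⟨n, hn⟩ := exists_eq_sawtooth_add φ
  have hm := sawtooth_mem φ
  have : ((QuotientAddGroup.mk' (AddSubgroup.zmultiples (2 * π))) φ : AddCircle (2 * π))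
      = ((sawtooth φ : ℝ) : AddCircle (2 * π)) := by
    change ((φ : ℝ) : AddCircle (2 * π)) = _
    conv_lhs => rw [hn]
    rw [AddCircle.coe_add, show 2 * π * (n : ℝ) = n • (2 * π) by rw [zsmul_eq_mul]; ring,
      AddCircle.coe_zsmul, AddCircle.coe_period, smul_zero, add_zero]
  rw [Function.comp_apply]
  change AddCircle.liftIco (2 * π) (-π) F
    ((QuotientAddGroup.mk' (AddSubgroup.zmultiples (2 * π))) φ : AddCircle (2 * π)) = _
  rw [this, AddCircle.liftIco_coe_apply ⟨hm.1, by linarith [hm.2]⟩]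

/-! ### The recursive construction of the normal form -/

/-- The correction to the Hamiltonian needed when the normal form fails by the remainder `Q`: the
average over the phase of the leading coefficient `Q(0, ·, τ)`. -/
def corrHam (Q : ℝ → ℝ → ℝ → ℝ) (τ : ℝ) : ℝ := (2 * π)⁻¹ * ∫ x in (-π)..π, Q 0 x τ

/-- The phase derivative of the correction to the generating function: the solution `u` of the
homological equation `π² / d² * u + Q(0, ·, τ) = corrHam Q τ`. -/
def corrForce (d : ℝ → ℝ) (Q : ℝ → ℝ → ℝ → ℝ) (x τ : ℝ) : ℝ :=
  d τ ^ 2 * (π ^ 2)⁻¹ * (corrHam Q τ - Q 0 x τ)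

/-- The correction to the generating function: the primitive of `corrForce` of zero average. -/
def corrGen (d : ℝ → ℝ) (Q : ℝ → ℝ → ℝ → ℝ) (x τ : ℝ) : ℝ :=
  (∫ y in (0)..x, corrForce d Q y τ)
    - (2 * π)⁻¹ * ∫ y in (-π)..π, ∫ w in (0)..y, corrForce d Q w τ

/-- The data of a normal form in the scaled variables `z = ε / Î`, `x` (the phase in `[-π, π]`)
and `τ`. The generating function is `gen (z, x, τ)`, the new Hamiltonian is
`Î² (π² / (2 d²) + ham (z, τ))`, and at stage `n` the Hamiltonian differs from it by
`Î² z ^ (n + 1) rem (z, x, τ)`. -/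
structure Stage where
  gen : ℝ → ℝ → ℝ → ℝ
  ham : ℝ → ℝ → ℝ
  rem : ℝ → ℝ → ℝ → ℝ

/-- The successive normal forms. Stage `0` is the given Hamiltonian; the remainder of stage `n + 1`
collects, after division by `z ^ (n + 2)`, the terms which the correction leaves over. -/
def stage (d : ℝ → ℝ) : ℕ → Stage
  | 0 => ⟨fun _ _ _ => 0, fun _ _ => 0, fun _ x τ => -(deriv d τ * (d τ)⁻¹ * x)⟩
  | n + 1 =>
    ⟨fun z x τ => (stage d n).gen z x τ + z ^ n * corrGen d (stage d n).rem x τ,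
     fun z τ => (stage d n).ham z τ + z ^ (n + 1) * corrHam (stage d n).rem τ,
     fun z x τ => divZ (stage d n).rem z x τ
      + corrForce d (stage d n).rem x τ *
        (π ^ 2 * (d τ)⁻¹ ^ 2 * dx (stage d n).gen z x τ - deriv d τ * (d τ)⁻¹ * x)
      + π ^ 2 * (d τ)⁻¹ ^ 2 / 2 * (z ^ n * corrForce d (stage d n).rem x τ ^ 2)
      + deriv (fun σ => corrGen d (stage d n).rem x σ) τ⟩

section correction

variable {d : ℝ → ℝ} {Q : ℝ → ℝ → ℝ → ℝ}

theorem polyFun_corrHam (hQ : PolyFun d Q) : PolyFun d (fun _ _ τ => corrHam Q τ) :=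
  (PolyFun.const _).mul ((hQ.comp_z 0).integral (-π) π)

theorem polyFun_corrForce (hQ : PolyFun d Q) : PolyFun d (fun _ x τ => corrForce d Q x τ) :=
  (((PolyFun.coeff (self_mem_coeffAlgebra d)).pow 2).mul (PolyFun.const _)).mul
    ((polyFun_corrHam hQ).sub (hQ.comp_z 0))

theorem polyFun_corrGen (hQ : PolyFun d Q) : PolyFun d (fun _ x τ => corrGen d Q x τ) :=
  (polyFun_corrForce hQ).primitive.sub
    ((PolyFun.const _).mul ((polyFun_corrForce hQ).primitive.integral (-π) π))

theorem continuous_corrForce (hQ : PolyFun d Q) (τ : ℝ) :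
    Continuous fun x => corrForce d Q x τ :=
  (polyFun_corrForce hQ).continuous_x 0 τ

theorem hasDerivAt_corrGen (hQ : PolyFun d Q) (x τ : ℝ) :
    HasDerivAt (fun y => corrGen d Q y τ) (corrForce d Q x τ) x :=
  ((continuous_corrForce hQ τ).integral_hasStrictDerivAt 0 x).hasDerivAt.sub_const _

theorem integral_corrForce (hQ : PolyFun d Q) (τ : ℝ) :
    ∫ x in (-π)..π, corrForce d Q x τ = 0 := by
  unfold corrForce
  rw [intervalIntegral.integral_const_mul, intervalIntegral.integral_sub
    intervalIntegrable_const ((hQ.continuous_x 0 τ).intervalIntegrable _ _),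
    intervalIntegral.integral_const, corrHam, smul_eq_mul]
  have := Real.pi_pos
  field_simp
  ring

theorem corrGen_pi (hQ : PolyFun d Q) (τ : ℝ) : corrGen d Q π τ = corrGen d Q (-π) τ := by
  have h := intervalIntegral.integral_interval_sub_left (μ := MeasureTheory.volume)
    ((continuous_corrForce hQ τ).intervalIntegrable 0 π)
    ((continuous_corrForce hQ τ).intervalIntegrable 0 (-π))
  rw [integral_corrForce hQ] at h
  unfold corrGen
  linarith

theorem integral_corrGen (hQ : PolyFun d Q) (τ : ℝ) :
    ∫ x in (-π)..π, corrGen d Q x τ = 0 := by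
  have hc := (polyFun_corrForce hQ).primitive.continuous_x 0 τ
  unfold corrGen
  rw [intervalIntegral.integral_sub (hc.intervalIntegrable _ _) intervalIntegrable_const,
    intervalIntegral.integral_const, smul_eq_mul]
  have := Real.pi_pos
  field_simp
  ring

end correction

section stages

variable {d : ℝ → ℝ}

theorem dx_stage_succ (n : ℕ) (hg : PolyFun d (stage d n).gen) (hr : PolyFun d (stage d n).rem)
    (z x τ : ℝ) : dx (stage d (n + 1)).gen z x τ
      = dx (stage d n).gen z x τ + z ^ n * corrForce d (stage d n).rem x τ :=
  ((hg.hasDerivAt_x z x τ).add ((hasDerivAt_corrGen hr x τ).const_mul (z ^ n))).deriv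

variable (hd : ContDiff ℝ ∞ d) (hd0 : ∀ τ, d τ ≠ 0)
include hd hd0

theorem polyFun_stage (n : ℕ) : PolyFun d (stage d n).gen ∧
    PolyFun d (fun z _ τ => (stage d n).ham z τ) ∧ PolyFun d (stage d n).rem := by
  have hrate : PolyFun d (fun _ x τ => deriv d τ * (d τ)⁻¹ * x) :=
    ((PolyFun.coeff (deriv_self_mem_coeffAlgebra d)).mul
      (PolyFun.coeff (inv_mem_coeffAlgebra d))).mul PolyFun.x_var
  have hω : PolyFun d (fun _ _ τ => π ^ 2 * (d τ)⁻¹ ^ 2) :=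
    (PolyFun.const _).mul ((PolyFun.coeff (inv_mem_coeffAlgebra d)).pow 2)
  induction n with
  | zero => exact ⟨PolyFun.const 0, PolyFun.const 0, hrate.neg⟩
  | succ n ih =>
    obtain ⟨hg, hh, hr⟩ := ih
    refine ⟨hg.add _ _ ((PolyFun.z_var.pow n).mul (polyFun_corrGen hr)),
      hh.add _ _ ((PolyFun.z_var.pow (n + 1)).mul (polyFun_corrHam hr)), ?_⟩
    have hu := polyFun_corrForce hr
    refine (((hr.divZ.add _ _ (hu.mul ((hω.mul hg.dx).sub hrate))).add _ _ ?_).add _ _ ?_)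
    · have h2 : PolyFun d (fun _ _ τ => π ^ 2 * (d τ)⁻¹ ^ 2 / 2) := by
        simpa only [div_eq_mul_inv] using hω.mul (PolyFun.const (2 : ℝ)⁻¹)
      exact h2.mul ((PolyFun.z_var.pow n).mul (hu.pow 2))
    · exact (polyFun_corrGen hr).dt hd hd0

theorem polyFun_gen (n : ℕ) : PolyFun d (stage d n).gen := (polyFun_stage hd hd0 n).1

theorem polyFun_ham (n : ℕ) : PolyFun d (fun z _ τ => (stage d n).ham z τ) :=
  (polyFun_stage hd hd0 n).2.1

theorem polyFun_rem (n : ℕ) : PolyFun d (stage d n).rem := (polyFun_stage hd hd0 n).2.2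

/-- The Hamiltonian in the scaled variables is in normal form up to order `z ^ (n + 1)`. -/
theorem stage_identity (n : ℕ) (z x τ : ℝ) :
    π ^ 2 * (d τ)⁻¹ ^ 2 / 2 * ((1 + z * dx (stage d n).gen z x τ) ^ 2 - 1)
      - z * (1 + z * dx (stage d n).gen z x τ) * (deriv d τ * (d τ)⁻¹ * x)
      + z ^ 2 * dt (stage d n).gen z x τ - (stage d n).ham z τ
      = z ^ (n + 1) * (stage d n).rem z x τ := by
  induction n with
  | zero =>
    have h1 : dx (stage d 0).gen z x τ = 0 := deriv_const _ _
    have h2 : dt (stage d 0).gen z x τ = 0 := deriv_const _ _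
    rw [h1, h2]
    simp only [stage]
    ring
  | succ n ih =>
    have hg := polyFun_gen hd hd0 n
    have hr := polyFun_rem hd hd0 n
    have h2 : dt (stage d (n + 1)).gen z x τ = dt (stage d n).gen z x τ
        + z ^ n * deriv (fun σ => corrGen d (stage d n).rem x σ) τ :=
      ((hg.hasDerivAt_t hd hd0 z x τ).add
        (((polyFun_corrGen hr).hasDerivAt_t hd hd0 z x τ).const_mul (z ^ n))).deriv
    rw [dx_stage_succ n hg hr, h2]
    have hQ := PolyFun.mul_divZ (F := (stage d n).rem) z x τ
    have hu : π ^ 2 * (d τ)⁻¹ ^ 2 * corrForce d (stage d n).rem x τ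
        = corrHam (stage d n).rem τ - (stage d n).rem 0 x τ := by
      have := hd0 τ
      have := Real.pi_pos
      unfold corrForce
      field_simp
    simp only [stage]
    linear_combination ih + z ^ (n + 1) * hu - z ^ (n + 1) * hQ

/-- The jump of the first generating function compensates the jump of the action at an impact with
the moving wall; apart from it everything matches at `x = ± π`. -/
theorem stage_jump (n : ℕ) (z τ : ℝ) :
    dx (stage d (n + 1)).gen z π τ = dx (stage d (n + 1)).gen z (-π) τ + 2 * d τ * deriv d τ / π ∧
      (stage d (n + 1)).rem z π τ = (stage d (n + 1)).rem z (-π) τ := by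
  have hπ := Real.pi_pos
  have hd0τ := hd0 τ
  induction n generalizing z with
  | zero =>
    have hr := polyFun_rem hd hd0 0
    -- The initial remainder is odd in the phase: its average vanishes, and `corrForce` is linear.
    have hη : ∀ σ, corrHam (stage d 0).rem σ = 0 := fun σ => by
      simp only [corrHam, stage]
      rw [intervalIntegral.integral_neg, intervalIntegral.integral_const_mul, integral_id]
      ring
    have hu : ∀ x σ, corrForce d (stage d 0).rem x σ = d σ * deriv d σ * (π ^ 2)⁻¹ * x :=
      fun x σ => by
        have := hd0 σ
        rw [corrForce, hη]
        simp only [stage]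
        field_simp
        ring
    have hs : ∀ σ, corrGen d (stage d 0).rem π σ = corrGen d (stage d 0).rem (-π) σ :=
      corrGen_pi hr
    have h0 : ∀ x, dx (stage d 0).gen z x τ = 0 := fun x => deriv_const _ _
    have hdz : ∀ x, divZ (stage d 0).rem z x τ = 0 := fun x => by
      simp only [divZ, stage]
      rcases eq_or_ne z 0 with rfl | h
      · rw [dslope_same, deriv_const]
      · rw [dslope_of_ne _ h, slope_def_field, sub_self, zero_div]
    constructor
    · rw [dx_stage_succ 0 (polyFun_gen hd hd0 0) hr, dx_stage_succ 0 (polyFun_gen hd hd0 0) hr,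
        h0, h0, hu, hu]
      field_simp
      ring
    · rw [stage]
      dsimp only
      rw [hdz, hdz, h0, h0, hu, hu]
      simp only [hs]
      ring
  | succ n ih =>
    have hg := polyFun_gen hd hd0 (n + 1)
    have hr := polyFun_rem hd hd0 (n + 1)
    have hu : corrForce d (stage d (n + 1)).rem π τ = corrForce d (stage d (n + 1)).rem (-π) τ := by
      rw [corrForce, corrForce, (ih 0).2]
    have hs : ∀ σ, corrGen d (stage d (n + 1)).rem π σ = corrGen d (stage d (n + 1)).rem (-π) σ :=
      corrGen_pi hr
    have hdz : divZ (stage d (n + 1)).rem z π τ = divZ (stage d (n + 1)).rem z (-π) τ := by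
      simp only [divZ, (ih _).2]
    constructor
    · rw [dx_stage_succ (n + 1) hg hr, dx_stage_succ (n + 1) hg hr, hu, (ih z).1]
      ring
    · rw [stage]
      dsimp only
      rw [hdz, hu, (ih z).1]
      simp only [hs]
      field_simp
      ring

/-- The equal values at `x = ± π` make the generating function continuous in the phase. -/
theorem gen_pi (n : ℕ) (z τ : ℝ) : (stage d n).gen z π τ = (stage d n).gen z (-π) τ := by
  induction n with
  | zero => rfl
  | succ n ih =>
    simp only [stage]
    rw [ih, corrGen_pi (polyFun_rem hd hd0 n)]

end stages

/-! ### Existence of the normal form -/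

/-- The functions `S i` of the constructed normal form. -/
def canonS (d : ℝ → ℝ) (i : ℕ) (J φ τ : ℝ) : ℝ :=
  (J ^ (i - 1))⁻¹ * corrGen d (stage d (i - 1)).rem (sawtooth φ) τ

/-- The functions `h i` of the constructed normal form. -/
def canonH (d : ℝ → ℝ) (i : ℕ) (J τ : ℝ) : ℝ :=
  J ^ 2 * (J ^ i)⁻¹ * corrHam (stage d (i - 1)).rem τ

/-- The generating function of order `n + 1` is that of stage `n`, in scaled variables. -/
theorem genS_canonS (d : ℝ → ℝ) (n : ℕ) (ε J φ τ : ℝ) :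
    genS (n + 1) (canonS d) ε J φ τ = (stage d n).gen (ε / J) (sawtooth φ) τ := by
  induction n with
  | zero => simp [genS, stage]
  | succ n ih =>
    simp only [genS, Nat.add_sub_cancel] at ih ⊢
    rw [Finset.sum_Icc_succ_top (by omega), ih]
    simp only [stage, canonS, Nat.add_sub_cancel, div_pow]
    ring

theorem sumH_canonH (d : ℝ → ℝ) (n : ℕ) (ε J τ : ℝ) :
    sumH d (n + 1) (canonH d) ε J τ
      = J ^ 2 * (π ^ 2 * (d τ)⁻¹ ^ 2 / 2 + (stage d n).ham (ε / J) τ) := by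
  induction n with
  | zero =>
    simp only [sumH, stage, energy]
    rw [Finset.Icc_eq_empty (by omega), Finset.sum_empty]
    ring
  | succ n ih =>
    simp only [sumH, Nat.add_sub_cancel] at ih ⊢
    rw [Finset.sum_Icc_succ_top (by omega), ← add_assoc, ih]
    simp only [stage, canonH, Nat.add_sub_cancel, div_pow]
    ring

section canon

variable {d : ℝ → ℝ} (hd : ContDiff ℝ ∞ d) (hd0 : ∀ τ, d τ ≠ 0)
include hd hd0

theorem hasDerivAt_genS_canonS (n : ℕ) (ε J τ : ℝ) {φ : ℝ} (hφ : ∀ n : ℤ, φ ≠ π + 2 * π * n) :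
    HasDerivAt (fun θ => genS (n + 1) (canonS d) ε J θ τ)
      (dx (stage d n).gen (ε / J) (sawtooth φ) τ) φ := by
  simp only [genS_canonS]
  have := ((polyFun_gen hd hd0 n).hasDerivAt_x (ε / J) (sawtooth φ) τ).comp φ
    (hasDerivAt_sawtooth hφ)
  rwa [mul_one] at this

theorem newHamiltonian_canonS (n : ℕ) {ε J φ τ : ℝ} (hJ : J ≠ 0)
    (hφ : ∀ n : ℤ, φ ≠ π + 2 * π * n) :
    newHamiltonian d (n + 1) (canonS d) ε J φ τ - sumH d (n + 1) (canonH d) ε J τ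
      = J ^ 2 * ((ε / J) ^ (n + 1) * (stage d n).rem (ε / J) (sawtooth φ) τ) := by
  have h1 := (hasDerivAt_genS_canonS hd hd0 n ε J τ hφ).deriv
  have h2 : deriv (fun σ => genS (n + 1) (canonS d) ε J φ σ) τ
      = dt (stage d n).gen (ε / J) (sawtooth φ) τ := by
    simp only [genS_canonS]
    rfl
  have hd0τ := hd0 τ
  rw [newHamiltonian, h1, h2, sumH_canonH, ← stage_identity hd hd0 n, hamiltonian, energy]
  field_simp
  ring

/-- The constructed functions bring the Hamiltonian to normal form. -/
theorem isNormalForm_canon {r : ℕ} (hr : 1 ≤ r) : IsNormalForm d r (canonS d) (canonH d) where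
  contDiffOn_S i _ φ := by
    have h := (polyFun_corrGen (polyFun_rem hd hd0 (i - 1))).contDiff_t hd hd0 0 (sawtooth φ)
    have h1 : ContDiffOn ℝ ∞ (fun p : ℝ × ℝ => (p.1 ^ (i - 1))⁻¹) (Ioi 0 ×ˢ univ) :=
      (contDiff_fst.pow _).contDiffOn.inv fun p hp => pow_ne_zero _ (ne_of_gt hp.1)
    exact h1.mul (h.comp contDiff_snd).contDiffOn
  contDiffOn_h i _ := by
    have h := (polyFun_corrHam (polyFun_rem hd hd0 (i - 1))).contDiff_t hd hd0 0 0
    have h1 : ContDiffOn ℝ ∞ (fun p : ℝ × ℝ => (p.1 ^ i)⁻¹) (Ioi 0 ×ˢ univ) :=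
      (contDiff_fst.pow _).contDiffOn.inv fun p hp => pow_ne_zero _ (ne_of_gt hp.1)
    exact ((contDiff_fst.pow 2).contDiffOn.mul h1).mul (h.comp contDiff_snd).contDiffOn
  continuous_S i _ J _ τ := by
    have hQ := polyFun_rem hd hd0 (i - 1)
    exact continuous_const.mul (continuous_comp_sawtooth (F := fun x => corrGen d _ x τ)
      ((polyFun_corrGen hQ).continuous_x 0 τ) (corrGen_pi hQ τ))
  periodic_S i _ J _ τ φ := by
    simp only [canonS, sawtooth_periodic φ]
  average_S i _ J _ τ := by
    have hQ := polyFun_rem hd hd0 (i - 1)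
    have hp : Function.Periodic (fun φ => canonS d i J φ τ) (2 * π) := fun φ => by
      simp only [canonS, sawtooth_periodic φ]
    have h := hp.intervalIntegral_add_eq 0 (-π)
    rw [zero_add, show -π + 2 * π = π by ring] at h
    rw [h]
    unfold canonS
    rw [intervalIntegral.integral_const_mul, intervalIntegral.integral_congr_ae
      (g := fun φ => corrGen d (stage d (i - 1)).rem φ τ), integral_corrGen hQ, mul_zero]
    have hne : ∀ᵐ φ : ℝ ∂MeasureTheory.volume, φ ≠ π := by
      simp [MeasureTheory.ae_iff]
    filter_upwards [hne] with φ hφ hmem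
    rw [uIoc_of_le (by linarith [Real.pi_pos])] at hmem
    rw [sawtooth_eq_self ⟨hmem.1.le, lt_of_le_of_ne hmem.2 hφ⟩]
  differentiableAt_S i _ J _ φ τ hφ := by
    have h := (hasDerivAt_corrGen (polyFun_rem hd hd0 (i - 1)) (sawtooth φ) τ).comp φ
      (hasDerivAt_sawtooth hφ)
    exact (h.differentiableAt).const_mul _
  normal_form J hJ φ τ hφ := by
    obtain ⟨n, rfl⟩ : ∃ n, r = n + 1 := ⟨r - 1, by omega⟩
    simp only [newHamiltonian_canonS hd hd0 n hJ.ne' hφ]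
    have hc : Tendsto (fun ε : ℝ => J ^ 2 * (J ^ (n + 1))⁻¹ *
        (stage d n).rem (ε / J) (sawtooth φ) τ) (𝓝[>] 0)
        (𝓝 (J ^ 2 * (J ^ (n + 1))⁻¹ * (stage d n).rem (0 / J) (sawtooth φ) τ)) := by
      have : Continuous fun ε : ℝ => J ^ 2 * (J ^ (n + 1))⁻¹ *
          (stage d n).rem (ε / J) (sawtooth φ) τ :=
        continuous_const.mul (((polyFun_rem hd hd0 n).continuous_z _ _).comp
          (continuous_id.div_const J))
      exact (this.tendsto 0).mono_left nhdsWithin_le_nhds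
    refine ((isBigO_refl (fun ε : ℝ => ε ^ (n + 1)) (𝓝[>] 0)).mul (hc.isBigO_one ℝ)).congr
      (fun ε => ?_) (fun ε => mul_one _)
    rw [div_pow]
    ring

end canon

/-! ### Uniqueness of the normal form -/

/-- A polynomial in `ε` whose coefficients below order `i` vanish is `ε ^ i` times a polynomial. -/
theorem sum_pow_mul_eq_pow_mul {δ : ℕ → ℝ} {i n : ℕ} (hi : 1 ≤ i) (hin : i ≤ n)
    (hδ : ∀ j ∈ Finset.Icc 1 n, j < i → δ j = 0) :
    ∃ p : ℝ → ℝ, Continuous p ∧ p 0 = δ i ∧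
      ∀ ε : ℝ, ∑ j ∈ Finset.Icc 1 n, ε ^ j * δ j = ε ^ i * p ε := by
  refine ⟨fun ε => ∑ j ∈ Finset.Icc i n, ε ^ (j - i) * δ j, by fun_prop, ?_, fun ε => ?_⟩
  · dsimp only
    rw [Finset.sum_eq_single_of_mem i (by simp [hin])]
    · simp
    · intro j hj hne
      have := (Finset.mem_Icc.1 hj).1
      rw [zero_pow (by omega), zero_mul]
  · rw [Finset.mul_sum, ← Finset.sum_subset (Finset.Icc_subset_Icc_left hi)]
    · refine Finset.sum_congr rfl fun j hj => ?_
      rw [← mul_assoc, ← pow_add, Nat.add_sub_cancel' (Finset.mem_Icc.1 hj).1]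
    · intro j hj hne
      rw [hδ j hj, mul_zero]
      simp only [Finset.mem_Icc] at hj hne
      omega

/-- Comparison of the leading coefficients of two normal forms which agree below order `i`. -/
theorem leading_coeff_eq {w κ J : ℝ} {i n : ℕ} (hi : 1 ≤ i) (hin : i ≤ n)
    {a a' b b' γ γ' : ℕ → ℝ} (ha : ∀ j ∈ Finset.Icc 1 n, j < i → a j = a' j)
    (hb : ∀ j ∈ Finset.Icc 1 n, j < i → b j = b' j)
    (hγ : ∀ j ∈ Finset.Icc 1 n, j < i → γ j = γ' j)
    (hO : (fun ε : ℝ =>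
      (w * (J + ∑ j ∈ Finset.Icc 1 n, ε ^ j * a j) ^ 2
        - ε * (J + ∑ j ∈ Finset.Icc 1 n, ε ^ j * a j) * κ
        + ε * ∑ j ∈ Finset.Icc 1 n, ε ^ j * b j - ∑ j ∈ Finset.Icc 1 n, ε ^ j * γ j)
      - (w * (J + ∑ j ∈ Finset.Icc 1 n, ε ^ j * a' j) ^ 2
        - ε * (J + ∑ j ∈ Finset.Icc 1 n, ε ^ j * a' j) * κ
        + ε * ∑ j ∈ Finset.Icc 1 n, ε ^ j * b' j - ∑ j ∈ Finset.Icc 1 n, ε ^ j * γ' j))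
      =O[𝓝[>] 0] fun ε => ε ^ (i + 1)) :
    2 * w * J * (a i - a' i) = γ i - γ' i := by
  obtain ⟨p, hp, hp0, hpe⟩ := sum_pow_mul_eq_pow_mul (δ := fun j => a j - a' j) hi hin
    fun j hj hji => sub_eq_zero.2 (ha j hj hji)
  obtain ⟨q, hq, hq0, hqe⟩ := sum_pow_mul_eq_pow_mul (δ := fun j => b j - b' j) hi hin
    fun j hj hji => sub_eq_zero.2 (hb j hj hji)
  obtain ⟨s, hs, hs0, hse⟩ := sum_pow_mul_eq_pow_mul (δ := fun j => γ j - γ' j) hi hin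
    fun j hj hji => sub_eq_zero.2 (hγ j hj hji)
  simp only [mul_sub, Finset.sum_sub_distrib] at hpe hqe hse
  set A : ℝ → ℝ := fun ε => ∑ j ∈ Finset.Icc 1 n, ε ^ j * a j with hA
  set A' : ℝ → ℝ := fun ε => ∑ j ∈ Finset.Icc 1 n, ε ^ j * a' j with hA'
  have hA0 : A 0 = 0 := Finset.sum_eq_zero fun j hj => by
    rw [zero_pow (by have := (Finset.mem_Icc.1 hj).1; omega), zero_mul]
  have hA'0 : A' 0 = 0 := Finset.sum_eq_zero fun j hj => by
    rw [zero_pow (by have := (Finset.mem_Icc.1 hj).1; omega), zero_mul]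
  let c : ℝ → ℝ := fun ε => p ε * (w * (2 * J + A ε + A' ε) - ε * κ) + ε * q ε - s ε
  have hc : Continuous c := by
    simp only [c, hA, hA']
    fun_prop
  have hO' : (fun ε => ε ^ i * c ε) =O[𝓝[>] 0] fun ε => ε ^ (i + 1) := by
    refine hO.congr_left fun ε => ?_
    simp only [c, hA, hA']
    linear_combination (w * (2 * J + A ε + A' ε) - ε * κ) * hpe ε + ε * hqe ε - hse ε
  obtain ⟨C, hC⟩ := hO'.bound
  have hlim : Tendsto c (𝓝[>] 0) (𝓝 0) := by
    refine squeeze_zero_norm' (a := fun ε => C * ε) ?_ ?_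
    · filter_upwards [hC, self_mem_nhdsWithin] with ε h hε
      have hε : 0 < ε := hε
      rw [norm_mul, norm_pow, norm_pow, Real.norm_of_nonneg hε.le] at h
      refine le_of_mul_le_mul_left (h.trans_eq ?_) (pow_pos hε i)
      ring
    · have : Tendsto (fun ε : ℝ => C * ε) (𝓝 0) (𝓝 (C * 0)) :=
        (continuous_const.mul continuous_id).tendsto 0
      rw [mul_zero] at this
      exact this.mono_left nhdsWithin_le_nhds
  have h0 : c 0 = 0 := tendsto_nhds_unique ((hc.tendsto 0).mono_left nhdsWithin_le_nhds) hlim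
  simp only [c, hA0, hA'0, hp0, hs0] at h0
  linear_combination h0

/-- A continuous periodic function of zero average vanishes if its derivative is constant off the
odd multiples of `π`: periodicity excludes a nonzero slope. -/
theorem eq_zero_of_deriv_const {E : ℝ → ℝ} {κ : ℝ} (hE : Continuous E)
    (hper : Function.Periodic E (2 * π))
    (hder : ∀ φ : ℝ, (∀ n : ℤ, φ ≠ π + 2 * π * n) → HasDerivAt E κ φ)
    (hint : ∫ φ in (0)..(2 * π), E φ = 0) : κ = 0 ∧ ∀ φ, E φ = 0 := by
  have hπ := Real.pi_pos
  have hlin : ∀ x ∈ Icc (-π) π, E x = E (-π) + κ * (x + π) := by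
    intro x hx
    rcases hx.1.eq_or_lt with rfl | hlt
    · ring
    · obtain ⟨c, -, hc⟩ := exists_hasDerivAt_eq_slope E (fun _ => κ) hlt hE.continuousOn
        fun y hy => hder y fun n hn => by
          have h1 : y < π := hy.2.trans_le hx.2
          have h2 : -π < y := hy.1
          rw [hn] at h1 h2
          have h3 : (n : ℝ) < 0 := by
            by_contra h
            nlinarith [not_lt.1 h]
          have h4 : (-1 : ℝ) < n := by
            by_contra h
            nlinarith [not_lt.1 h]
          have h3' : n < 0 := by exact_mod_cast h3
          have h4' : -1 < n := by exact_mod_cast h4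
          omega
      have hne : x - -π ≠ 0 := by linarith
      rw [eq_div_iff hne] at hc
      linarith
  have hκ : κ = 0 := by
    have h1 := hlin π ⟨by linarith, le_rfl⟩
    have h2 := hper (-π)
    rw [show -π + 2 * π = π by ring] at h2
    rw [h2] at h1
    have : κ * (π + π) = 0 := by linarith
    exact (mul_eq_zero.1 this).resolve_right (by linarith)
  have hconst : ∀ φ, E φ = E (-π) := fun φ => by
    obtain ⟨n, hn⟩ := exists_eq_sawtooth_add φ
    have hm := sawtooth_mem φ
    have h1 := hper.int_mul n (sawtooth φ)
    rw [show sawtooth φ + (n : ℝ) * (2 * π) = φ by linarith] at h1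
    rw [h1, hlin _ ⟨hm.1, hm.2.le⟩, hκ, zero_mul, add_zero]
  refine ⟨hκ, fun φ => ?_⟩
  rw [intervalIntegral.integral_congr (g := fun _ => E (-π)) (fun x _ => hconst x),
    intervalIntegral.integral_const, smul_eq_mul] at hint
  rw [hconst]
  exact (mul_eq_zero.1 hint).resolve_left (by linarith)

/-- The difference of the two Hamiltonians, expanded as a polynomial in `ε`. -/
theorem newHamiltonian_sub_sumH {d : ℝ → ℝ} {r : ℕ} {S : ℕ → ℝ → ℝ → ℝ → ℝ}
    {h : ℕ → ℝ → ℝ → ℝ} (H : IsNormalForm d r S h) {J : ℝ} (hJ : 0 < J) {φ : ℝ} (τ : ℝ)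
    (hφ : ∀ n : ℤ, φ ≠ π + 2 * π * n) (ε : ℝ) :
    newHamiltonian d r S ε J φ τ - sumH d r h ε J τ
      = (π ^ 2 / (2 * d τ ^ 2) * (J + ∑ j ∈ Finset.Icc 1 (r - 1),
            ε ^ j * deriv (fun θ => S j J θ τ) φ) ^ 2
        - ε * (J + ∑ j ∈ Finset.Icc 1 (r - 1), ε ^ j * deriv (fun θ => S j J θ τ) φ)
          * (deriv d τ / d τ * sawtooth φ)
        + ε * ∑ j ∈ Finset.Icc 1 (r - 1), ε ^ j * deriv (fun σ => S j J φ σ) τ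
        - ∑ j ∈ Finset.Icc 1 (r - 1), ε ^ j * h j J τ) - energy d J τ := by
  have hmul : ∀ f : ℕ → ℝ, ε * ∑ j ∈ Finset.Icc 1 (r - 1), ε ^ (j - 1) * f j
      = ∑ j ∈ Finset.Icc 1 (r - 1), ε ^ j * f j := fun f => by
    rw [Finset.mul_sum]
    refine Finset.sum_congr rfl fun j hj => ?_
    rw [← mul_assoc, ← pow_succ', Nat.sub_add_cancel (Finset.mem_Icc.1 hj).1]
  have h1 : deriv (fun θ => genS r S ε J θ τ) φ
      = ∑ j ∈ Finset.Icc 1 (r - 1), ε ^ (j - 1) * deriv (fun θ => S j J θ τ) φ := by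
    refine HasDerivAt.deriv ?_
    unfold genS
    exact HasDerivAt.fun_sum fun j hj =>
      ((H.differentiableAt_S j hj J hJ φ τ hφ).hasDerivAt).const_mul _
  have h2 : deriv (fun σ => genS r S ε J φ σ) τ
      = ∑ j ∈ Finset.Icc 1 (r - 1), ε ^ (j - 1) * deriv (fun σ => S j J φ σ) τ := by
    refine HasDerivAt.deriv ?_
    unfold genS
    refine HasDerivAt.fun_sum fun j hj => HasDerivAt.const_mul _ ?_
    have hc := (H.contDiffOn_S j hj φ).contDiffAt
      (prod_mem_nhds (Ioi_mem_nhds hJ) univ_mem : Ioi (0 : ℝ) ×ˢ univ ∈ 𝓝 (J, τ))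
    have hpair : DifferentiableAt ℝ (fun σ : ℝ => (J, σ)) τ := by fun_prop
    exact ((hc.differentiableAt (by simp)).comp τ hpair).hasDerivAt
  rw [newHamiltonian, h1, h2, hmul, pow_two ε, mul_assoc ε ε, hmul, hamiltonian, energy, sumH]
  ring

/-- The zero average and the continuity of the `S i` determine the normal form. -/
theorem IsNormalForm.eq_of_isNormalForm {d : ℝ → ℝ} (hd0 : ∀ τ, d τ ≠ 0) {r : ℕ}
    {S S' : ℕ → ℝ → ℝ → ℝ → ℝ} {h h' : ℕ → ℝ → ℝ → ℝ}
    (H : IsNormalForm d r S h) (H' : IsNormalForm d r S' h') (i : ℕ)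
    (hi : i ∈ Finset.Icc 1 (r - 1)) :
    (∀ J > 0, ∀ τ, h i J τ = h' i J τ) ∧ ∀ J > 0, ∀ φ τ, S i J φ τ = S' i J φ τ := by
  induction i using Nat.strong_induction_on with
  | _ i ih =>
    have hπ := Real.pi_pos
    obtain ⟨hi1, hir⟩ := Finset.mem_Icc.1 hi
    have key : ∀ J > 0, ∀ τ, h i J τ = h' i J τ ∧ ∀ φ, S i J φ τ = S' i J φ τ := by
      intro J hJ τ
      set w := π ^ 2 / (2 * d τ ^ 2) with hw
      have hwJ : 2 * w * J ≠ 0 := by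
        have := hd0 τ
        positivity
      have hcoef : ∀ φ : ℝ, (∀ n : ℤ, φ ≠ π + 2 * π * n) →
          2 * w * J * (deriv (fun θ => S i J θ τ) φ - deriv (fun θ => S' i J θ τ) φ)
            = h i J τ - h' i J τ := by
        intro φ hφ
        have hO := (H.normal_form J hJ φ τ hφ).sub (H'.normal_form J hJ φ τ hφ)
        simp only [newHamiltonian_sub_sumH H hJ τ hφ, newHamiltonian_sub_sumH H' hJ τ hφ,
          sub_sub_sub_cancel_right] at hO
        have hle : (fun ε : ℝ => ε ^ r) =O[𝓝[>] 0] fun ε => ε ^ (i + 1) := by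
          rcases (show i + 1 ≤ r by omega).eq_or_lt with rfl | hlt
          · exact isBigO_refl _ _
          · exact (isLittleO_pow_pow hlt).isBigO.mono nhdsWithin_le_nhds
        refine leading_coeff_eq (a := fun j => deriv (fun θ => S j J θ τ) φ)
          (a' := fun j => deriv (fun θ => S' j J θ τ) φ)
          (b := fun j => deriv (fun σ => S j J φ σ) τ)
          (b' := fun j => deriv (fun σ => S' j J φ σ) τ)
          (γ := fun j => h j J τ) (γ' := fun j => h' j J τ) hi1 hir
          (fun j hj hji => ?_) (fun j hj hji => ?_) (fun j hj hji => ?_) (hO.trans hle)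
        · simp only [(ih j hji hj).2 J hJ]
        · simp only [(ih j hji hj).2 J hJ]
        · exact (ih j hji hj).1 J hJ τ
      have hE := eq_zero_of_deriv_const (E := fun φ => S i J φ τ - S' i J φ τ)
        (κ := (h i J τ - h' i J τ) / (2 * w * J))
        ((H.continuous_S i hi J hJ τ).sub (H'.continuous_S i hi J hJ τ))
        ((H.periodic_S i hi J hJ τ).sub (H'.periodic_S i hi J hJ τ))
        (fun φ hφ => by
          rw [← hcoef φ hφ, mul_div_cancel_left₀ _ hwJ]
          exact ((H.differentiableAt_S i hi J hJ φ τ hφ).hasDerivAt).sub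
            ((H'.differentiableAt_S i hi J hJ φ τ hφ).hasDerivAt))
        (by
          rw [intervalIntegral.integral_sub
            ((H.continuous_S i hi J hJ τ).intervalIntegrable _ _)
            ((H'.continuous_S i hi J hJ τ).intervalIntegrable _ _),
            H.average_S i hi J hJ τ, H'.average_S i hi J hJ τ, sub_zero])
      exact ⟨sub_eq_zero.1 ((div_eq_zero_iff.1 hE.1).resolve_right hwJ),
        fun φ => sub_eq_zero.1 (hE.2 φ)⟩
    exact ⟨fun J hJ τ => (key J hJ τ).1, fun J hJ φ τ => (key J hJ τ).2 φ⟩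

/-! ### Uniform estimates and the implicit equation for the improved action -/

/-- All derivatives of `d`, including `d` itself, are bounded on the set `U` of slow times. -/
def IsBoundedOn (d : ℝ → ℝ) (U : Set ℝ) : Prop :=
  ∀ n : ℕ, ∃ M : ℝ, ∀ τ ∈ U, |iteratedDeriv n d τ| ≤ M

section estimates

variable {d : ℝ → ℝ} {c : ℝ} (hc : 0 < c) (hdc : ∀ τ, c ≤ d τ) {U : Set ℝ} (hU : IsBoundedOn d U)
include hc hdc hU

theorem PolyFun.exists_bound {F : ℝ → ℝ → ℝ → ℝ} (hF : PolyFun d F) :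
    ∃ M > 0, ∀ τ ∈ U, ∀ x z : ℝ, |x| ≤ π → |z| ≤ 1 → |F z x τ| ≤ M := by
  obtain ⟨M, hM⟩ := hF.bounded hc hdc hU
  exact ⟨|M| + 1, by positivity, fun τ hτ x z hx hz =>
    (hM τ hτ x z hx hz).trans ((le_abs_self M).trans (by linarith))⟩

theorem PolyFun.exists_lipschitz {F : ℝ → ℝ → ℝ → ℝ} (hF : PolyFun d F) :
    ∃ M > 0, ∀ τ ∈ U, ∀ x z₁ z₂ : ℝ, |x| ≤ π → |z₁| ≤ 1 → |z₂| ≤ 1 →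
      |F z₁ x τ - F z₂ x τ| ≤ M * |z₁ - z₂| := by
  obtain ⟨M, hM0, hM⟩ := hF.dz.exists_bound hc hdc hU
  refine ⟨M, hM0, fun τ hτ x z₁ z₂ hx h₁ h₂ => ?_⟩
  have := (convex_Icc (-1 : ℝ) 1).norm_image_sub_le_of_norm_hasDerivWithin_le
    (f := fun z => F z x τ) (C := M) (fun z _ => (hF.hasDerivAt_z z x τ).hasDerivWithinAt)
    (fun z hz => hM τ hτ x z hx (abs_le.2 hz)) (abs_le.1 h₂) (abs_le.1 h₁)
  simpa only [Real.norm_eq_abs] using this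

/-- The equation `I = J + ε F(ε / J, x, τ)` is uniformly solvable for `J` close to `I`: the
perturbation is `O(ε)`, and a contraction of constant `1 / 2` in `J`. -/
theorem exists_solve {F : ℝ → ℝ → ℝ → ℝ} (hF : PolyFun d F) {α : ℝ} (hα : 0 < α) :
    ∃ ε₀ > 0, ∃ M > 0, ∀ ε ∈ Ioo 0 ε₀, ∀ τ ∈ U, ∀ x : ℝ, |x| ≤ π →
      (∀ J₁ J₂, α / 2 ≤ J₁ → α / 2 ≤ J₂ →
        |J₁ - J₂| ≤ 2 * |J₁ + ε * F (ε / J₁) x τ - (J₂ + ε * F (ε / J₂) x τ)|) ∧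
      (∀ J, α / 2 ≤ J → |ε * F (ε / J) x τ| ≤ M * ε) ∧
      ∀ I, α ≤ I → ∃ J ∈ Ioo (I / 2) (2 * I), I = J + ε * F (ε / J) x τ := by
  obtain ⟨M, hM0, hM⟩ := hF.exists_bound hc hdc hU
  obtain ⟨K, hK0, hK⟩ := hF.exists_lipschitz hc hdc hU
  refine ⟨min (α / 2) (min (α / (4 * K)) (α / (2 * M))), by positivity, M, hM0, ?_⟩
  intro ε hε τ hτ x hx
  have hε0 : 0 < ε := hε.1
  have h1 : ε < α / 2 := hε.2.trans_le (min_le_left _ _)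
  have h2 : ε * (4 * K) < α :=
    (lt_div_iff₀ (by positivity)).1
      (hε.2.trans_le ((min_le_right _ _).trans (min_le_left _ _)))
  have h3 : ε * (2 * M) < α :=
    (lt_div_iff₀ (by positivity)).1
      (hε.2.trans_le ((min_le_right _ _).trans (min_le_right _ _)))
  have hz : ∀ J, α / 2 ≤ J → |ε / J| ≤ 1 := fun J hJ => by
    have hJ0 : 0 < J := by linarith
    rw [abs_of_pos (by positivity), div_le_one hJ0]
    linarith
  have hB : ∀ J, α / 2 ≤ J → |ε * F (ε / J) x τ| ≤ M * ε := fun J hJ => by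
    rw [abs_mul, abs_of_pos hε0, mul_comm]
    exact mul_le_mul_of_nonneg_right (hM τ hτ x _ hx (hz J hJ)) hε0.le
  refine ⟨fun J₁ J₂ hJ₁ hJ₂ => ?_, hB, fun I hI => ?_⟩
  · have hJ₁0 : 0 < J₁ := by linarith
    have hJ₂0 : 0 < J₂ := by linarith
    have hl := hK τ hτ x _ _ hx (hz J₁ hJ₁) (hz J₂ hJ₂)
    have he : ε / J₁ - ε / J₂ = -(ε / J₁ * (J₁ - J₂) / J₂) := by
      field_simp
      ring
    have hzz : |ε / J₁ - ε / J₂| ≤ |J₁ - J₂| / J₂ := by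
      rw [he, abs_neg, abs_div, abs_mul, abs_of_pos hJ₂0]
      gcongr
      exact mul_le_of_le_one_left (abs_nonneg _) (hz J₁ hJ₁)
    have h4 : |ε * F (ε / J₁) x τ - ε * F (ε / J₂) x τ| ≤ |J₁ - J₂| / 2 := by
      rw [← mul_sub, abs_mul, abs_of_pos hε0]
      calc ε * |F (ε / J₁) x τ - F (ε / J₂) x τ| ≤ ε * (K * (|J₁ - J₂| / J₂)) := by
            gcongr
            exact hl.trans (by gcongr)
        _ = ε * K / J₂ * |J₁ - J₂| := by ring
        _ ≤ 1 / 2 * |J₁ - J₂| := by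
            refine mul_le_mul_of_nonneg_right ?_ (abs_nonneg _)
            rw [div_le_iff₀ hJ₂0]
            linarith
        _ = |J₁ - J₂| / 2 := by ring
    have h5 := abs_sub_abs_le_abs_sub (J₁ - J₂) (-(ε * F (ε / J₁) x τ - ε * F (ε / J₂) x τ))
    rw [abs_neg, show J₁ - J₂ - -(ε * F (ε / J₁) x τ - ε * F (ε / J₂) x τ)
      = J₁ + ε * F (ε / J₁) x τ - (J₂ + ε * F (ε / J₂) x τ) by ring] at h5
    linarith
  · have hI0 : 0 < I := by linarith
    have hcont : ContinuousOn (fun J => J + ε * F (ε / J) x τ) (Icc (I / 2) (2 * I)) := by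
      refine continuousOn_id.add (continuousOn_const.mul ?_)
      exact (hF.continuous_z x τ).comp_continuousOn
        (continuousOn_const.div continuousOn_id fun J hJ => by
          have := hJ.1
          exact ne_of_gt (show (0 : ℝ) < J by linarith))
    have hlo := abs_le.1 (hB (I / 2) (by linarith))
    have hhi := abs_le.1 (hB (2 * I) (by linarith))
    obtain ⟨J, hJ, hJe⟩ := intermediate_value_Ioo (by linarith : I / 2 ≤ 2 * I) hcont
      (show I ∈ Ioo _ _ from ⟨by linarith [hlo.2], by linarith [hhi.1]⟩)
    exact ⟨J, hJ, hJe.symm⟩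

end estimates

/-! ### Motion between the walls -/

/-- The frequency of the phase in the normal form at stage `n`, divided by the action: if the new
Hamiltonian is `Î² N (ε / Î)`, its derivative in `Î` is `Î (2 N - z N')` at `z = ε / Î`. -/
def scaledFreq (d : ℝ → ℝ) (n : ℕ) (z τ : ℝ) : ℝ :=
  π ^ 2 * (d τ)⁻¹ ^ 2 + 2 * (stage d n).ham z τ - z * deriv (fun y => (stage d n).ham y τ) z

section drift

variable {d : ℝ → ℝ} (hd : ContDiff ℝ ∞ d) (hd0 : ∀ τ, d τ ≠ 0)
include hd hd0

/-- The derivative of `stage_identity` in `x`. -/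
theorem stage_identity_dx (n : ℕ) (z x τ : ℝ) :
    π ^ 2 * (d τ)⁻¹ ^ 2 * (1 + z * dx (stage d n).gen z x τ) * (z * dx (dx (stage d n).gen) z x τ)
      - z * (deriv d τ * (d τ)⁻¹) * (1 + z * dx (stage d n).gen z x τ
        + z * dx (dx (stage d n).gen) z x τ * x)
      + z ^ 2 * dt (dx (stage d n).gen) z x τ = z ^ (n + 1) * dx (stage d n).rem z x τ := by
  have hg := polyFun_gen hd hd0 n
  have h1 := hg.dx.hasDerivAt_x z x τ
  have h2 := (hg.dt hd hd0).hasDerivAt_x z x τ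
  have h3 := ((polyFun_rem hd hd0 n).hasDerivAt_x z x τ).const_mul (z ^ (n + 1))
  rw [← hg.dt_dx hd hd0] at h2
  have h4 := (h1.const_mul z).const_add 1
  have h5 := ((((h4.pow 2).sub_const 1).const_mul (π ^ 2 * (d τ)⁻¹ ^ 2 / 2)).sub
    ((h4.const_mul z).mul ((hasDerivAt_id x).const_mul (deriv d τ * (d τ)⁻¹)))).add
      (h2.const_mul (z ^ 2)) |>.sub_const ((stage d n).ham z τ)
  have h6 := h5.congr_of_eventuallyEq (f₁ := fun y => z ^ (n + 1) * (stage d n).rem z y τ)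
    (Eventually.of_forall fun y => (stage_identity hd hd0 n z y τ).symm)
  have h7 := h6.unique h3
  simp only [id_eq, mul_one, Nat.cast_ofNat, Nat.add_one_sub_one, pow_one] at h7
  linear_combination h7

/-- The combination `2 · stage_identity - z · ∂/∂z stage_identity`, which by homogeneity expresses
the derivative of the normal form with respect to the action at fixed `ε`. -/
theorem stage_identity_dz (n : ℕ) (z x τ : ℝ) :
    (π ^ 2 * (d τ)⁻¹ ^ 2 * (1 + z * dx (stage d n).gen z x τ) - z * (deriv d τ * (d τ)⁻¹ * x))
        * (1 - z ^ 2 * dx (dz (stage d n).gen) z x τ) - z ^ 3 * dt (dz (stage d n).gen) z x τ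
      = scaledFreq d n z τ + z ^ (n + 1) *
        ((1 - n) * (stage d n).rem z x τ - z * dz (stage d n).rem z x τ) := by
  have hg := polyFun_gen hd hd0 n
  have h1 := hg.dx.hasDerivAt_z z x τ
  have h2 := (hg.dt hd hd0).hasDerivAt_z z x τ
  have h3 := (hasDerivAt_pow (n + 1) z).mul ((polyFun_rem hd hd0 n).hasDerivAt_z z x τ)
  rw [← hg.dt_dz hd hd0] at h2
  rw [hg.dz_dx] at h1
  have hN := (polyFun_ham hd hd0 n).hasDerivAt_z z x τ
  have h4 := ((hasDerivAt_id z).mul h1).const_add 1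
  have h5 := ((((h4.pow 2).sub_const 1).const_mul (π ^ 2 * (d τ)⁻¹ ^ 2 / 2)).sub
    (((hasDerivAt_id z).mul h4).mul_const (deriv d τ * (d τ)⁻¹ * x))).add
      ((hasDerivAt_pow 2 z).mul h2) |>.sub hN
  have h6 := h5.congr_of_eventuallyEq
    (f₁ := (fun y => y ^ (n + 1)) * fun y => (stage d n).rem y x τ)
    (Eventually.of_forall fun y => (stage_identity hd hd0 n y x τ).symm)
  have h7 := h6.unique h3
  have h8 := stage_identity hd hd0 n z x τ
  have hN' : dz (fun z _ τ => (stage d n).ham z τ) z x τ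
      = deriv (fun y => (stage d n).ham y τ) z := rfl
  rw [hN'] at h7
  simp only [id_eq, one_mul, Nat.cast_ofNat, Nat.add_one_sub_one, pow_one, Pi.mul_apply,
    Nat.cast_add, Nat.cast_one] at h7
  unfold scaledFreq
  linear_combination 2 * h8 - z * h7

/-- Along a short piece of free flight the equation for the improved action and the equation of
motion of the improved phase hold up to `O(ε ^ (n + 1))`. Here `I` and `X` are the action and the
phase in `[-π, π]`, and `J` is the improved action at the beginning `p`. -/
theorem exists_drift {c : ℝ} (hc : 0 < c) (hdc : ∀ τ, c ≤ d τ) {U : Set ℝ} (hU : IsBoundedOn d U)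
    (n : ℕ) {α β Λ : ℝ} (hα : 0 < α) (hΛ : 0 < Λ) :
    ∃ ε₀ > 0, ∃ C > 0, ∀ ε ∈ Ioo 0 ε₀, ∀ p q : ℝ, p ≤ q → q - p ≤ Λ →
      (∀ u ∈ Icc p q, ε * u ∈ U) → ∀ X I : ℝ → ℝ,
      (∀ u ∈ Icc p q, HasDerivAt X
        (π ^ 2 * (d (ε * u))⁻¹ ^ 2 * I u
          - ε * (deriv d (ε * u) * (d (ε * u))⁻¹) * X u) u) →
      (∀ u ∈ Icc p q, HasDerivAt I (ε * (deriv d (ε * u) * (d (ε * u))⁻¹) * I u) u) →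
      (∀ u ∈ Icc p q, |X u| ≤ π) → ∀ J ∈ Icc α β,
      I p = J + ε * dx (stage d n).gen (ε / J) (X p) (ε * p) →
      |I q - (J + ε * dx (stage d n).gen (ε / J) (X q) (ε * q))| ≤ C * ε ^ (n + 1) * (q - p) ∧
      ∀ (ψ g : ℝ → ℝ) (G : ℝ), (∀ u ∈ Icc p q, HasDerivWithinAt ψ (g u) (Icc p q) u) →
        (∀ u ∈ Icc p q, |g u - J * scaledFreq d n (ε / J) (ε * u)| ≤ G) →
        |X q - (ε / J) ^ 2 * dz (stage d n).gen (ε / J) (X q) (ε * q)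
          - (X p - (ε / J) ^ 2 * dz (stage d n).gen (ε / J) (X p) (ε * p)) - (ψ q - ψ p)|
          ≤ (C * ε ^ (n + 1) + G) * (q - p) := by
  have hg := polyFun_gen hd hd0 n
  have hr := polyFun_rem hd hd0 n
  have hfreq : PolyFun d (fun _ _ τ => π ^ 2 * (d τ)⁻¹ ^ 2) :=
    (PolyFun.const _).mul ((PolyFun.coeff (inv_mem_coeffAlgebra d)).pow 2)
  have hrate : PolyFun d (fun _ _ τ => deriv d τ * (d τ)⁻¹) :=
    (PolyFun.coeff (deriv_self_mem_coeffAlgebra d)).mul (PolyFun.coeff (inv_mem_coeffAlgebra d))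
  obtain ⟨A, hA0, hA⟩ := hr.dx.exists_bound hc hdc hU
  obtain ⟨B, hB0, hB⟩ := (hrate.sub (hfreq.mul hg.dx.dx)).exists_bound hc hdc hU
  obtain ⟨E, hE0, hE⟩ := (((PolyFun.const (1 - n : ℝ)).mul hr).sub
    (PolyFun.z_var.mul hr.dz)).exists_bound hc hdc hU
  obtain ⟨K, hK0, hK⟩ := (hfreq.mul ((PolyFun.const 1).sub
    ((PolyFun.z_var.pow 2).mul hg.dz.dx))).exists_bound hc hdc hU
  set β' := max β 1 with hβ'
  have hβ'0 : 0 < β' := lt_of_lt_of_le one_pos (le_max_right _ _)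
  set a := (α ^ (n + 1))⁻¹ with ha
  have ha0 : 0 < a := by positivity
  set C₁ := 2 * (β' ^ 2 * a * A) with hC₁
  set C₂ := β' * a * E + K * (C₁ * Λ) with hC₂
  have hC₁0 : 0 < C₁ := by positivity
  have hC₂0 : 0 < C₂ := by positivity
  refine ⟨min α (1 / (2 * B * Λ)), by positivity, C₁ + C₂, by positivity, ?_⟩
  intro ε hε p q hpq hlen hmem X I hX hI hXπ J hJ hIp
  have hε0 : 0 < ε := hε.1
  have hεα : ε < α := hε.2.trans_le (min_le_left _ _)
  have hεB : ε * (2 * B * Λ) < 1 :=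
    (lt_div_iff₀ (by positivity)).1 (hε.2.trans_le (min_le_right _ _))
  have hJ0 : 0 < J := hα.trans_le hJ.1
  have hJβ : J ≤ β' := hJ.2.trans (le_max_left _ _)
  obtain ⟨z, hz⟩ : ∃ z, z = ε / J := ⟨_, rfl⟩
  rw [← hz] at hIp ⊢
  have hz0 : 0 < z := by
    rw [hz]
    positivity
  have hz1 : |z| ≤ 1 := by
    rw [abs_of_pos hz0, hz, div_le_one hJ0]
    exact hεα.le.trans hJ.1
  have hJz : J * z = ε := by
    rw [hz, mul_div_cancel₀ _ hJ0.ne']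
  have hzn : z ^ (n + 1) ≤ a * ε ^ (n + 1) := by
    rw [hz, div_pow, div_eq_mul_inv, mul_comm, ha]
    gcongr
    exact hJ.1
  have hεn : 0 < ε ^ (n + 1) := by positivity
  have hτ : ∀ u, HasDerivAt (fun u => ε * u) ε u := fun u => by
    simpa using (hasDerivAt_id u).const_mul ε
  -- The defect of the equation for the improved action, with the action `J` frozen.
  set D : ℝ → ℝ := fun u => I u - (J + ε * dx (stage d n).gen z (X u) (ε * u)) with hD
  have hDp : D p = 0 := by
    simp only [hD]
    rw [hIp]
    ring
  have hDder : ∀ u ∈ Icc p q, HasDerivAt D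
      (-(J ^ 2 * (z ^ (n + 1) * dx (stage d n).rem z (X u) (ε * u)))
        + ε * D u * (deriv d (ε * u) * (d (ε * u))⁻¹
          - π ^ 2 * (d (ε * u))⁻¹ ^ 2 * dx (dx (stage d n).gen) z (X u) (ε * u))) u := by
    intro u hu
    have h1 := hg.dx.hasDerivAt_comp hd hd0 z (hX u hu) (hτ u)
    refine ((hI u hu).sub ((h1.const_mul ε).const_add J)).congr_deriv ?_
    have h2 := stage_identity_dx hd hd0 n z (X u) (ε * u)
    have h3 : I u = D u + (J + ε * dx (stage d n).gen z (X u) (ε * u)) := by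
      simp only [hD]
      ring
    rw [h3]
    linear_combination -J ^ 2 * h2 - ((ε + J * z) *
      (deriv d (ε * u) * (d (ε * u))⁻¹ * (dx (stage d n).gen z (X u) (ε * u)
          + X u * dx (dx (stage d n).gen) z (X u) (ε * u))
        - π ^ 2 * (d (ε * u))⁻¹ ^ 2 * dx (stage d n).gen z (X u) (ε * u)
          * dx (dx (stage d n).gen) z (X u) (ε * u)
        - dt (dx (stage d n).gen) z (X u) (ε * u))
      + J * (deriv d (ε * u) * (d (ε * u))⁻¹
        - π ^ 2 * (d (ε * u))⁻¹ ^ 2 * dx (dx (stage d n).gen) z (X u) (ε * u))) * hJz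
  have hcont : ContinuousOn D (Icc p q) := fun u hu =>
    (hDder u hu).continuousAt.continuousWithinAt
  -- `|D w|` is the maximum of the defect over the flight.
  obtain ⟨w, hw, hwmax⟩ := isCompact_Icc.exists_isMaxOn (nonempty_Icc.2 hpq) hcont.abs
  have hmax : ∀ u ∈ Icc p q, |D u| ≤ |D w| := fun u hu => hwmax hu
  have hbound : ∀ u ∈ Icc p q, |D u| ≤ (C₁ / 2 * ε ^ (n + 1) + ε * |D w| * B) * (u - p) := by
    have := norm_image_sub_le_of_norm_deriv_le_segment' (f := D)
      (fun u hu => (hDder u hu).hasDerivWithinAt)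
      (C := C₁ / 2 * ε ^ (n + 1) + ε * |D w| * B) (fun u hu => ?_)
    · intro u hu
      have h := this u hu
      rwa [hDp, sub_zero] at h
    · have hu' := Ico_subset_Icc_self hu
      refine (norm_add_le _ _).trans (add_le_add ?_ ?_)
      · rw [norm_neg, Real.norm_eq_abs, abs_mul, abs_mul, abs_of_pos (by positivity : 0 < J ^ 2),
          abs_of_pos (by positivity : 0 < z ^ (n + 1))]
        calc J ^ 2 * (z ^ (n + 1) * |dx (stage d n).rem z (X u) (ε * u)|)
            ≤ β' ^ 2 * (a * ε ^ (n + 1) * A) := by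
              gcongr
              exact hA _ (hmem u hu') _ _ (hXπ u hu') hz1
          _ = C₁ / 2 * ε ^ (n + 1) := by
              rw [hC₁]
              ring
      · rw [Real.norm_eq_abs, abs_mul, abs_mul, abs_of_pos hε0]
        exact mul_le_mul (mul_le_mul_of_nonneg_left (hmax u hu') hε0.le)
          (hB _ (hmem u hu') _ _ (hXπ u hu') hz1) (abs_nonneg _) (by positivity)
  -- The flight is so short that the defect cannot amplify itself.
  have hDw : |D w| ≤ C₁ * Λ * ε ^ (n + 1) := by
    have h1 := hbound w hw
    have h2 : (C₁ / 2 * ε ^ (n + 1) + ε * |D w| * B) * (w - p)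
        ≤ (C₁ / 2 * ε ^ (n + 1) + ε * |D w| * B) * Λ := by
      gcongr
      linarith [hw.2]
    have h3 : ε * (2 * B * Λ) * |D w| ≤ 1 * |D w| := by gcongr
    nlinarith
  have hDu : ∀ u ∈ Icc p q, |D u| ≤ C₁ * ε ^ (n + 1) * (u - p) := by
    intro u hu
    refine (hbound u hu).trans (mul_le_mul_of_nonneg_right ?_ (by linarith [hu.1]))
    have h3 : ε * B * |D w| ≤ ε * B * (C₁ * Λ * ε ^ (n + 1)) := by gcongr
    have h4 : ε * (2 * B * Λ) * (C₁ * ε ^ (n + 1)) ≤ 1 * (C₁ * ε ^ (n + 1)) := by gcongr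
    nlinarith
  have hqp : 0 ≤ q - p := sub_nonneg.2 hpq
  refine ⟨?_, fun ψ g G hψ hgG => ?_⟩
  · refine (hDu q (right_mem_Icc.2 hpq)).trans ?_
    gcongr
    linarith
  · set Θ : ℝ → ℝ := fun u => X u - z ^ 2 * dz (stage d n).gen z (X u) (ε * u) with hΘ
    have hΘder : ∀ u ∈ Icc p q, HasDerivAt Θ (J * scaledFreq d n z (ε * u)
        + (J * (z ^ (n + 1) * ((1 - n) * (stage d n).rem z (X u) (ε * u)
            - z * dz (stage d n).rem z (X u) (ε * u)))
          + D u * (π ^ 2 * (d (ε * u))⁻¹ ^ 2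
            * (1 - z ^ 2 * dx (dz (stage d n).gen) z (X u) (ε * u))))) u := by
      intro u hu
      have h1 := hg.dz.hasDerivAt_comp hd hd0 z (hX u hu) (hτ u)
      refine ((hX u hu).sub (h1.const_mul (z ^ 2))).congr_deriv ?_
      have h2 := stage_identity_dz hd hd0 n z (X u) (ε * u)
      have h3 : I u = D u + (J + ε * dx (stage d n).gen z (X u) (ε * u)) := by
        simp only [hD]
        ring
      rw [h3]
      linear_combination J * h2 - ((π ^ 2 * (d (ε * u))⁻¹ ^ 2 * dx (stage d n).gen z (X u) (ε * u)
        - deriv d (ε * u) * (d (ε * u))⁻¹ * X u)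
        * (1 - z ^ 2 * dx (dz (stage d n).gen) z (X u) (ε * u))
        - z ^ 2 * dt (dz (stage d n).gen) z (X u) (ε * u)) * hJz
    have := norm_image_sub_le_of_norm_deriv_le_segment' (f := fun u => Θ u - ψ u)
      (fun u hu => (hΘder u hu).hasDerivWithinAt.sub (hψ u hu))
      (C := C₂ * ε ^ (n + 1) + G) (fun u hu => ?_) q (right_mem_Icc.2 hpq)
    · rw [Real.norm_eq_abs, show Θ q - ψ q - (Θ p - ψ p) = Θ q - Θ p - (ψ q - ψ p) by ring]
        at this
      refine this.trans (mul_le_mul_of_nonneg_right ?_ hqp)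
      have : C₂ * ε ^ (n + 1) ≤ (C₁ + C₂) * ε ^ (n + 1) := by
        gcongr
        linarith
      linarith
    · have hu' := Ico_subset_Icc_self hu
      have h1 := hgG u hu'
      rw [abs_sub_comm] at h1
      rw [Real.norm_eq_abs, add_sub_right_comm]
      refine ((abs_add_le _ _).trans (add_le_add h1 (abs_add_le _ _))).trans ?_
      rw [add_comm _ G]
      gcongr
      rw [hC₂, add_mul]
      refine add_le_add ?_ ?_
      · rw [abs_mul, abs_mul, abs_of_pos hJ0, abs_of_pos (by positivity : 0 < z ^ (n + 1))]
        calc J * (z ^ (n + 1) * |(1 - n) * (stage d n).rem z (X u) (ε * u)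
                - z * dz (stage d n).rem z (X u) (ε * u)|)
            ≤ β' * (a * ε ^ (n + 1) * E) := by
              gcongr
              exact hE _ (hmem u hu') _ _ (hXπ u hu') hz1
          _ = β' * a * E * ε ^ (n + 1) := by ring
      · rw [abs_mul]
        calc |D u| * _ ≤ C₁ * Λ * ε ^ (n + 1) * K := by
              gcongr
              · exact (hmax u hu').trans hDw
              · exact hK _ (hmem u hu') _ _ (hXπ u hu') hz1
          _ = K * (C₁ * Λ) * ε ^ (n + 1) := by ring

end drift

/-- The direction of a flight: `1` towards the moving wall, `-1` otherwise. -/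
def direction (w : ℝ) : ℝ := if 0 < w then 1 else -1

theorem abs_direction (w : ℝ) : |direction w| = 1 := by
  unfold direction
  split_ifs <;> simp

theorem direction_mul_self (w : ℝ) : direction w * w = |w| := by
  unfold direction
  split_ifs with h
  · rw [one_mul, abs_of_pos h]
  · rw [neg_one_mul, abs_of_nonpos (not_lt.1 h)]

/-- The phase in `[-π, π]` at time `t` and position `y`, on a flight with velocity `w`. -/
def flightPhase (d : ℝ → ℝ) (ε w y t : ℝ) : ℝ := direction w * (π * (y / d (ε * t)))

theorem abs_flightPhase_le {d : ℝ → ℝ} {ε w y t : ℝ} (h : 0 < d (ε * t))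
    (hy : y ∈ Icc 0 (d (ε * t))) : |flightPhase d ε w y t| ≤ π := by
  have hπ := Real.pi_pos
  rw [flightPhase, abs_mul, abs_direction, one_mul, abs_mul, abs_of_pos hπ,
    abs_of_nonneg (div_nonneg hy.1 h.le)]
  exact mul_le_of_le_one_right hπ.le ((div_le_one h).2 hy.2)

/-- The difference `φ - φ̂` of the phase and the improved phase. -/
def phaseCorr (d : ℝ → ℝ) (n : ℕ) (ε J X τ : ℝ) : ℝ :=
  (ε / J) ^ 2 * dz (stage d n).gen (ε / J) X τ

section flight

variable {d : ℝ → ℝ} (hd : ContDiff ℝ ∞ d) {c : ℝ} (hc : 0 < c) (hdc : ∀ τ, c ≤ d τ)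
include hd hc hdc

theorem exists_phaseCorr_lipschitz {U : Set ℝ} (hU : IsBoundedOn d U) (n : ℕ) {α : ℝ}
    (hα : 0 < α) :
    ∃ M > 0, ∀ ε ∈ Ioo 0 α, ∀ τ ∈ U, ∀ X : ℝ, |X| ≤ π → ∀ J₁ J₂, α ≤ J₁ → α ≤ J₂ →
      |phaseCorr d n ε J₁ X τ - phaseCorr d n ε J₂ X τ| ≤ M * |J₁ - J₂| := by
  have hd0 : ∀ τ, d τ ≠ 0 := fun τ => (hc.trans_le (hdc τ)).ne'
  have hF := (PolyFun.z_var.pow 2).mul (polyFun_gen hd hd0 n).dz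
  obtain ⟨M, hM0, hM⟩ := hF.exists_lipschitz hc hdc hU
  refine ⟨M / α, by positivity, fun ε hε τ hτ X hX J₁ J₂ h₁ h₂ => ?_⟩
  have hJ₁ : 0 < J₁ := hα.trans_le h₁
  have hJ₂ : 0 < J₂ := hα.trans_le h₂
  have hε0 : 0 < ε := hε.1
  have hz : ∀ J, α ≤ J → |ε / J| ≤ 1 := fun J hJ => by
    have hJ0 : 0 < J := hα.trans_le hJ
    rw [abs_of_pos (by positivity), div_le_one hJ0]
    exact hε.2.le.trans hJ
  refine (hM τ hτ X _ _ hX (hz J₁ h₁) (hz J₂ h₂)).trans ?_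
  have he : ε / J₁ - ε / J₂ = -(ε / J₁ * (J₁ - J₂) / J₂) := by
    field_simp
    ring
  have hzz : |ε / J₁ - ε / J₂| ≤ |J₁ - J₂| / α := by
    rw [he, abs_neg, abs_div, abs_mul, abs_of_pos hJ₂]
    gcongr
    exact mul_le_of_le_one_left (abs_nonneg _) (hz J₁ h₁)
  calc M * |ε / J₁ - ε / J₂| ≤ M * (|J₁ - J₂| / α) := by gcongr
    _ = M / α * |J₁ - J₂| := by ring

/-- Along a free flight with action of order one the improved action changes by at most
`O(ε ^ (n + 1))` per unit of time, and so does the error of the improved phase. -/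
theorem exists_flight {U : Set ℝ} (hU : IsBoundedOn d U) (n : ℕ) {α β : ℝ} (hα : 0 < α)
    (hβ : 0 < β) :
    ∃ ε₀ > 0, ∃ C > 0, ∀ ε ∈ Ioo 0 ε₀, ∀ p q : ℝ, p ≤ q → (∀ u ∈ Icc p q, ε * u ∈ U) →
      ∀ (x : ℝ → ℝ) (w : ℝ), (∀ u ∈ Icc p q, x u = x p + w * (u - p)) →
      (∀ u ∈ Icc p q, x u ∈ Icc 0 (d (ε * u))) → d (ε * p) * |w| / π ∈ Icc α β →
      ∀ J ∈ Icc (α / 2) (2 * β),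
      d (ε * p) * |w| / π
        = J + ε * dx (stage d n).gen (ε / J) (flightPhase d ε w (x p) p) (ε * p) →
      d (ε * q) * |w| / π ∈ Icc (α / 2) (2 * β) ∧
      ∃ J' ∈ Ioo (d (ε * q) * |w| / π / 2) (2 * (d (ε * q) * |w| / π)),
        d (ε * q) * |w| / π
          = J' + ε * dx (stage d n).gen (ε / J') (flightPhase d ε w (x q) q) (ε * q) ∧
        |J' - J| ≤ C * ε ^ (n + 1) * (q - p) ∧
        ∀ (ψ g : ℝ → ℝ) (G : ℝ), (∀ u ∈ Icc p q, HasDerivWithinAt ψ (g u) (Icc p q) u) →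
          (∀ u ∈ Icc p q, |g u - J * scaledFreq d n (ε / J) (ε * u)| ≤ G) →
          |flightPhase d ε w (x q) q - phaseCorr d n ε J' (flightPhase d ε w (x q) q) (ε * q)
            - (flightPhase d ε w (x p) p
              - phaseCorr d n ε J (flightPhase d ε w (x p) p) (ε * p)) - (ψ q - ψ p)|
            ≤ (C * ε ^ (n + 1) + G) * (q - p) := by
  have hπ := Real.pi_pos
  have hdpos : ∀ τ, 0 < d τ := fun τ => hc.trans_le (hdc τ)
  have hd0 : ∀ τ, d τ ≠ 0 := fun τ => (hdpos τ).ne'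
  obtain ⟨B, hB0, hB⟩ :=
    (PolyFun.coeff (self_mem_coeffAlgebra d)).exists_bound hc hdc hU
  obtain ⟨M, hM0, hM⟩ :=
    (PolyFun.coeff (deriv_self_mem_coeffAlgebra d)).exists_bound hc hdc hU
  -- The flight from one wall to the other takes at most the time `Λ`.
  set Λ := B ^ 2 / (π * α) with hΛ
  have hΛ0 : 0 < Λ := by positivity
  obtain ⟨ε₁, hε₁, C₁, hC₁, hdrift⟩ :=
    exists_drift hd hd0 hc hdc hU n (α := α / 2) (β := 2 * β) (half_pos hα) hΛ0
  obtain ⟨ε₂, hε₂, K, hK, hsolve⟩ :=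
    exists_solve hc hdc hU (polyFun_gen hd hd0 n).dx (half_pos hα)
  obtain ⟨N, hN0, hN⟩ := exists_phaseCorr_lipschitz hd hc hdc hU n (α := α / 4) (by positivity)
  refine ⟨min (min ε₁ ε₂) (min (α / 4) (min (α * c / (2 * (β * M * Λ))) (c / (M * Λ)))),
    by positivity, 2 * C₁ + N * (2 * C₁) + C₁, by positivity, ?_⟩
  intro ε hε p q hpq hmem x w hline hwalls hI J hJ hJeq
  have hε0 : 0 < ε := hε.1
  have he₁ : ε ∈ Ioo 0 ε₁ := ⟨hε0, hε.2.trans_le ((min_le_left _ _).trans (min_le_left _ _))⟩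
  have he₂ : ε ∈ Ioo 0 ε₂ := ⟨hε0, hε.2.trans_le ((min_le_left _ _).trans (min_le_right _ _))⟩
  have he₃ : ε < α / 4 := hε.2.trans_le ((min_le_right _ _).trans (min_le_left _ _))
  have he₄ : ε * (2 * (β * M * Λ)) < α * c :=
    (lt_div_iff₀ (by positivity)).1 (hε.2.trans_le
      ((min_le_right _ _).trans ((min_le_right _ _).trans (min_le_left _ _))))
  have he₅ : ε * (M * Λ) < c :=
    (lt_div_iff₀ (by positivity)).1 (hε.2.trans_le
      ((min_le_right _ _).trans ((min_le_right _ _).trans (min_le_right _ _))))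
  have hp : p ∈ Icc p q := left_mem_Icc.2 hpq
  have hq : q ∈ Icc p q := right_mem_Icc.2 hpq
  have hqp : 0 ≤ q - p := sub_nonneg.2 hpq
  have hBd : ∀ u ∈ Icc p q, d (ε * u) ≤ B := fun u hu =>
    (le_abs_self _).trans (hB _ (hmem u hu) 0 0 (by simp [hπ.le]) (by simp))
  have hw : π * α ≤ B * |w| := by
    have h1 := (le_div_iff₀ hπ).1 hI.1
    have h2 : d (ε * p) * |w| ≤ B * |w| := mul_le_mul_of_nonneg_right (hBd p hp) (abs_nonneg _)
    linarith
  have hw0 : 0 < |w| := pos_of_mul_pos_right (lt_of_lt_of_le (by positivity) hw) hB0.le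
  have hlen : q - p ≤ Λ := by
    have h1 := hline q hq
    have h2 : |w| * (q - p) ≤ B := by
      rw [← abs_of_nonneg hqp, ← abs_mul, abs_le]
      have := hwalls p hp
      have := hwalls q hq
      have := hBd p hp
      have := hBd q hq
      constructor <;> linarith [(hwalls p hp).1, (hwalls p hp).2, (hwalls q hq).1, (hwalls q hq).2]
    rw [hΛ, le_div_iff₀ (by positivity)]
    calc (q - p) * (π * α) ≤ (q - p) * (B * |w|) := by gcongr
      _ = B * (|w| * (q - p)) := by ring
      _ ≤ B * B := by gcongr
      _ = B ^ 2 := by ring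
  have hτ : ∀ u, HasDerivAt (fun u => ε * u) ε u := fun u => by
    simpa using (hasDerivAt_id u).const_mul ε
  have hdder : ∀ u, HasDerivAt (fun u => d (ε * u)) (deriv d (ε * u) * ε) u := fun u =>
    ((hd.differentiable (by simp) (ε * u)).hasDerivAt).comp u (hτ u)
  have hdlip : |d (ε * q) - d (ε * p)| ≤ M * ε * Λ := by
    have := norm_image_sub_le_of_norm_deriv_le_segment' (f := fun u => d (ε * u)) (C := M * ε)
      (fun u _ => (hdder u).hasDerivWithinAt) (fun u hu => by
        rw [Real.norm_eq_abs, abs_mul, abs_of_pos hε0]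
        exact mul_le_mul_of_nonneg_right
          (hM _ (hmem u (Ico_subset_Icc_self hu)) 0 0 (by simp [hπ.le]) (by simp)) hε0.le) q hq
    exact this.trans (by gcongr)
  have hIq : d (ε * q) * |w| / π ∈ Icc (α / 2) (2 * β) := by
    have h1 : |w| / π ≤ β / c := by
      rw [div_le_div_iff₀ hπ hc]
      have h2 := (div_le_iff₀ hπ).1 hI.2
      have h3 : c * |w| ≤ d (ε * p) * |w| := mul_le_mul_of_nonneg_right (hdc _) (abs_nonneg _)
      linarith
    have h4 : |d (ε * q) * |w| / π - d (ε * p) * |w| / π| ≤ M * ε * Λ * (β / c) := by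
      rw [show d (ε * q) * |w| / π - d (ε * p) * |w| / π
        = (d (ε * q) - d (ε * p)) * (|w| / π) by ring, abs_mul,
        abs_of_nonneg (by positivity : 0 ≤ |w| / π)]
      gcongr
    have h5 : M * ε * Λ * (β / c) ≤ α / 2 := by
      rw [← mul_div_assoc, div_le_iff₀ hc]
      linarith
    have h6 : M * ε * Λ * (β / c) ≤ β := by
      rw [← mul_div_assoc, div_le_iff₀ hc]
      calc M * ε * Λ * β = ε * (M * Λ) * β := by ring
        _ ≤ c * β := by gcongr
        _ = β * c := by ring
    have h7 := abs_le.1 h4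
    exact ⟨by linarith [hI.1, h7.1], by linarith [hI.2, h7.2]⟩
  set y : ℝ → ℝ := fun u => x p + w * (u - p) with hy
  have hyx : ∀ u ∈ Icc p q, y u = x u := fun u hu => (hline u hu).symm
  have hyder : ∀ u, HasDerivAt y w u := fun u =>
    ((((hasDerivAt_id u).sub_const p).const_mul w).const_add (x p)).congr_deriv (mul_one w)
  obtain ⟨hD, hΘ⟩ := hdrift ε he₁ p q hpq hlen hmem (fun u => flightPhase d ε w (y u) u)
    (fun u => d (ε * u) * |w| / π)
    (fun u _ => by
      have h := (((hyder u).div (hdder u) (hd0 _)).const_mul π).const_mul (direction w)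
      refine HasDerivAt.congr_deriv h ?_
      have := hd0 (ε * u)
      rw [flightPhase, ← direction_mul_self]
      field_simp)
    (fun u _ => by
      refine HasDerivAt.congr_deriv (((hdder u).mul_const |w|).div_const π) ?_
      have := hd0 (ε * u)
      field_simp)
    (fun u hu => abs_flightPhase_le (hdpos _) (by rw [hyx u hu]; exact hwalls u hu)) J hJ
    (by simpa only [hyx p hp] using hJeq)
  simp only [hyx p hp, hyx q hq] at hD hΘ
  have hXq : |flightPhase d ε w (x q) q| ≤ π := abs_flightPhase_le (hdpos _) (hwalls q hq)
  obtain ⟨hinj, -, hex⟩ := hsolve ε he₂ (ε * q) (hmem q hq) _ hXq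
  obtain ⟨J', hJ', hJ'eq⟩ := hex _ hIq.1
  have hJ'α : α / 2 / 2 ≤ J' := by linarith [hJ'.1, hIq.1]
  have hJα : α / 2 / 2 ≤ J := by linarith [hJ.1]
  have hJJ : |J' - J| ≤ 2 * C₁ * ε ^ (n + 1) * (q - p) := by
    have h := hinj J' J hJ'α hJα
    rw [← hJ'eq] at h
    linarith
  have hεn : 0 ≤ ε ^ (n + 1) * (q - p) := by positivity
  refine ⟨hIq, J', hJ', hJ'eq, hJJ.trans ?_, fun ψ g G hψ hg => ?_⟩
  · have : 0 ≤ (N * (2 * C₁) + C₁) * (ε ^ (n + 1) * (q - p)) := by positivity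
    linarith
  · have h1 : |flightPhase d ε w (x q) q - phaseCorr d n ε J (flightPhase d ε w (x q) q) (ε * q)
        - (flightPhase d ε w (x p) p - phaseCorr d n ε J (flightPhase d ε w (x p) p) (ε * p))
        - (ψ q - ψ p)| ≤ (C₁ * ε ^ (n + 1) + G) * (q - p) := hΘ ψ g G hψ hg
    have h2 := hN ε ⟨hε0, he₃⟩ (ε * q) (hmem q hq) _ hXq J J' (by linarith) (by linarith)
    rw [abs_sub_comm J J'] at h2
    have h3 : N * |J' - J| ≤ N * (2 * C₁ * ε ^ (n + 1) * (q - p)) := by gcongr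
    have h4 := abs_add_le (phaseCorr d n ε J (flightPhase d ε w (x q) q) (ε * q)
      - phaseCorr d n ε J' (flightPhase d ε w (x q) q) (ε * q))
      (flightPhase d ε w (x q) q - phaseCorr d n ε J (flightPhase d ε w (x q) q) (ε * q)
        - (flightPhase d ε w (x p) p - phaseCorr d n ε J (flightPhase d ε w (x p) p) (ε * p))
        - (ψ q - ψ p))
    have h5 : 0 ≤ (2 * C₁) * (ε ^ (n + 1) * (q - p)) := by positivity
    rw [show flightPhase d ε w (x q) q - phaseCorr d n ε J' (flightPhase d ε w (x q) q) (ε * q)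
            - (flightPhase d ε w (x p) p
              - phaseCorr d n ε J (flightPhase d ε w (x p) p) (ε * p)) - (ψ q - ψ p)
        = phaseCorr d n ε J (flightPhase d ε w (x q) q) (ε * q)
      - phaseCorr d n ε J' (flightPhase d ε w (x q) q) (ε * q) +
      (flightPhase d ε w (x q) q - phaseCorr d n ε J (flightPhase d ε w (x q) q) (ε * q)
        - (flightPhase d ε w (x p) p - phaseCorr d n ε J (flightPhase d ε w (x p) p) (ε * p))
        - (ψ q - ψ p)) by ring]
    linarith

end flight

/-! ### Flights and impacts of a motion -/

section motion

variable {d : ℝ → ℝ} {ε L : ℝ} {x v Φ : ℝ → ℝ}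

/-- Free flight, forwards or backwards in time, between two times of an interval whose interior
contains no impact. -/
theorem IsMotion.free_of_not_isImpact (hM : IsMotion d ε L x v) {p q : ℝ} (hp : 0 ≤ p)
    (hq : q ≤ L) (hno : ∀ u ∈ Ioo p q, ¬ IsImpact d ε x u) {m u : ℝ} (hm : m ∈ Icc p q)
    (hmi : ¬ IsImpact d ε x m) (hu : u ∈ Icc p q) (hui : ¬ IsImpact d ε x u) :
    v u = v m ∧ x u = x m + v m * (u - m) := by
  have hno' : ∀ w, (w = m ∨ w = u ∨ w ∈ Ioo p q) → ¬ IsImpact d ε x w := by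
    rintro w (rfl | rfl | h)
    exacts [hmi, hui, hno w h]
  rcases le_total u m with h | h
  · obtain ⟨h1, h2⟩ := hM.free_flight u m (hp.trans hu.1) h (hm.2.trans hq) fun w hw => by
      refine hno' w ?_
      rcases hw.1.eq_or_lt with rfl | h1
      · exact Or.inr (Or.inl rfl)
      rcases hw.2.eq_or_lt with rfl | h2
      · exact Or.inl rfl
      exact Or.inr (Or.inr ⟨hu.1.trans_lt h1, h2.trans_le hm.2⟩)
    refine ⟨h1.symm, ?_⟩
    rw [h2, h1]
    ring
  · refine hM.free_flight m u (hp.trans hm.1) h (hu.2.trans hq) fun w hw => ?_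
    refine hno' w ?_
    rcases hw.1.eq_or_lt with rfl | h1
    · exact Or.inl rfl
    rcases hw.2.eq_or_lt with rfl | h2
    · exact Or.inr (Or.inl rfl)
    exact Or.inr (Or.inr ⟨hm.1.trans_lt h1, h2.trans_le hu.2⟩)

/-- The motion is linear up to and including the impacts at the ends of a flight. -/
theorem IsMotion.eq_line (hM : IsMotion d ε L x v) {p q : ℝ} (hp : 0 ≤ p) (hq : q ≤ L)
    (hpq : p < q) (hno : ∀ u ∈ Ioo p q, ¬ IsImpact d ε x u) {m : ℝ} (hm : m ∈ Icc p q)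
    (hmi : ¬ IsImpact d ε x m) : ∀ u ∈ Icc p q, x u = x m + v m * (u - m) := by
  have hc : ContinuousOn x (Icc p q) := hM.continuousOn.mono (Icc_subset_Icc hp hq)
  refine Set.EqOn.of_subset_closure (s := Ioo p q) (fun u hu => ?_) hc (by fun_prop)
    Ioo_subset_Icc_self (closure_Ioo hpq.ne).ge
  exact (hM.free_of_not_isImpact hp hq hno hm hmi (Ioo_subset_Icc_self hu) (hno u hu)).2

/-- At an impact the phases computed for the two directions of flight agree modulo `2π`. Hence the
phase of the flight with velocity `w` describes the motion also at the ends of the flight, where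
the value of `v` is arbitrary. -/
theorem exists_phase_eq (hd0 : ∀ τ, d τ ≠ 0) {w u : ℝ} (h : IsImpact d ε x u ∨ v u = w) :
    ∃ n : ℤ, phase d ε x v u = flightPhase d ε w (x u) u + 2 * π * n := by
  have hdu := hd0 (ε * u)
  rcases h with (h | h) | rfl
  · refine ⟨if 0 < v u then 0 else 1, ?_⟩
    rw [phase, flightPhase, h]
    split_ifs
    · simp
    · simp; ring
  · refine ⟨if 0 < w then 0 else 1, ?_⟩
    rw [phase, flightPhase, h, direction, div_self hdu]
    split_ifs <;> simp <;> ring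
  · refine ⟨if 0 < v u then 0 else 1, ?_⟩
    rw [phase, flightPhase, direction]
    split_ifs
    · simp
    · simp; ring

/-- During a flight, up to and including the impacts at its ends, the lifted phase differs from the
phase in `[-π, π]` by a constant. -/
theorem IsLiftedPhase.sub_eq (hd : Continuous d) (hd0 : ∀ τ, d τ ≠ 0)
    (hM : IsMotion d ε L x v) (hΦ : IsLiftedPhase d ε L x v Φ) {p q : ℝ} (hp : 0 ≤ p) (hq : q ≤ L)
    (hpq : p ≤ q) (hno : ∀ u ∈ Ioo p q, ¬ IsImpact d ε x u) {m : ℝ} (hm : m ∈ Icc p q)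
    (hmi : ¬ IsImpact d ε x m) :
    Φ q - Φ p = flightPhase d ε (v m) (x q) q - flightPhase d ε (v m) (x p) p := by
  have hsub : Icc p q ⊆ Icc 0 L := Icc_subset_Icc hp hq
  have hint : ∀ u ∈ Icc p q, ∃ n : ℤ,
      (Φ u - flightPhase d ε (v m) (x u) u) / (2 * π) = n := by
    intro u hu
    obtain ⟨n, hn⟩ := hΦ.2 u (hsub hu)
    obtain ⟨k, hk⟩ := exists_phase_eq (v := v) (w := v m) (u := u) (x := x) (ε := ε) hd0 (by
      by_cases hui : IsImpact d ε x u
      · exact Or.inl hui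
      · exact Or.inr (hM.free_of_not_isImpact hp hq hno hm hmi hu hui).1)
    refine ⟨k + n, ?_⟩
    have := Real.pi_pos
    rw [hn, hk]
    push_cast
    field_simp
    ring
  have hcont : ContinuousOn (fun u => (Φ u - flightPhase d ε (v m) (x u) u) / (2 * π))
      (Icc p q) := by
    refine ((hΦ.1.mono hsub).sub ?_).div_const _
    unfold flightPhase
    refine continuousOn_const.mul (continuousOn_const.mul
      ((hM.continuousOn.mono hsub).div ?_ fun u _ => hd0 _))
    exact (hd.comp (continuous_const.mul continuous_id)).continuousOn
  -- A continuous function with integer values on an interval is constant.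
  have hdisc : DiscreteTopology (range ((↑) : ℤ → ℝ)) :=
    Int.isClosedEmbedding_coe_real.isEmbedding.toHomeomorph.symm.isEmbedding.discreteTopology
  have hconst := isPreconnected_Icc.constant_of_mapsTo
    (T := range ((↑) : ℤ → ℝ)) ⟨hdisc⟩ hcont (fun u hu => by
      obtain ⟨n, hn⟩ := hint u hu
      exact ⟨n, hn.symm⟩) (left_mem_Icc.2 hpq) (right_mem_Icc.2 hpq)
  have := Real.pi_pos
  field_simp at hconst
  linarith

theorem IsMotion.abs_flightPhase_lt (hM : IsMotion d ε L x v) (hdpos : ∀ τ, 0 < d τ) {t : ℝ}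
    (ht : t ∈ Icc 0 L) (hti : ¬ IsImpact d ε x t) (w : ℝ) :
    |flightPhase d ε w (x t) t| < π := by
  have hπ := Real.pi_pos
  have hx := hM.mem_walls t ht
  have hlt : x t < d (ε * t) := lt_of_le_of_ne hx.2 fun h => hti (Or.inr h)
  rw [flightPhase, abs_mul, abs_direction, one_mul, abs_mul, abs_of_pos hπ,
    abs_of_nonneg (div_nonneg hx.1 (hdpos _).le)]
  exact mul_lt_of_lt_one_right hπ ((div_lt_one (hdpos _)).2 hlt)

theorem IsLiftedPhase.sawtooth_eq (hdpos : ∀ τ, 0 < d τ)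
    (hM : IsMotion d ε L x v) (hΦ : IsLiftedPhase d ε L x v Φ) {t : ℝ} (ht : t ∈ Icc 0 L)
    (hti : ¬ IsImpact d ε x t) : sawtooth (Φ t) = flightPhase d ε (v t) (x t) t := by
  obtain ⟨n, hn⟩ := hΦ.2 t ht
  obtain ⟨k, hk⟩ := exists_phase_eq (v := v) (w := v t) (u := t) (x := x) (ε := ε)
    (fun τ => (hdpos τ).ne') (Or.inr rfl)
  have h2 := abs_lt.1 (hM.abs_flightPhase_lt hdpos ht hti (v t))
  refine sawtooth_eq_of_eq_add ⟨h2.1.le, h2.2⟩ (n := k + n) ?_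
  rw [hn, hk]
  push_cast
  ring

/-- Off the walls the phase avoids the discontinuities of the sawtooth function. -/
theorem IsLiftedPhase.ne_pi (hdpos : ∀ τ, 0 < d τ)
    (hM : IsMotion d ε L x v) (hΦ : IsLiftedPhase d ε L x v Φ) {t : ℝ} (ht : t ∈ Icc 0 L)
    (hti : ¬ IsImpact d ε x t) (n : ℤ) : Φ t ≠ π + 2 * π * n := by
  intro h
  have h1 : sawtooth (Φ t) = -π := by
    refine sawtooth_eq_of_eq_add ⟨le_rfl, by linarith [Real.pi_pos]⟩ (n := n + 1) ?_
    rw [h]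
    push_cast
    ring
  have h2 := abs_lt.1 (hM.abs_flightPhase_lt hdpos ht hti (v t))
  rw [← hΦ.sawtooth_eq hdpos hM ht hti, h1] at h2
  exact lt_irrefl _ h2.1

/-- The change of the velocity at an impact between two flights. The hypotheses `hslow` and `hslow'`
express that the particle is faster than the moving wall: it meets that wall only when moving to the
right, and is sent back to the left. -/
theorem IsMotion.impact (hM : IsMotion d ε L x v) {s i t : ℝ} (hs : 0 ≤ s) (hsi : s < i)
    (hit : i < t) (ht : t ≤ L) (hno₁ : ∀ u ∈ Ico s i, ¬ IsImpact d ε x u)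
    (hno₂ : ∀ u ∈ Ioc i t, ¬ IsImpact d ε x u) (himp : IsImpact d ε x i)
    (hslow : d (ε * s) < d (ε * i) + |v s| * (i - s))
    (hslow' : 2 * (ε * deriv d (ε * i)) < |v s|) :
    (x i = 0 ∧ |v t| = |v s|) ∨
      (x i = d (ε * i) ∧ 0 < v s ∧ v t < 0 ∧ |v t| = |v s| - 2 * (ε * deriv d (ε * i))) := by
  have hi : i ∈ Ioo 0 L := ⟨hs.trans_lt hsi, hit.trans_le ht⟩
  have hno₁' : ∀ u ∈ Ioo s i, ¬ IsImpact d ε x u := fun u hu => hno₁ u ⟨hu.1.le, hu.2⟩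
  have hno₂' : ∀ u ∈ Ioo i t, ¬ IsImpact d ε x u := fun u hu => hno₂ u ⟨hu.1, hu.2.le⟩
  have hsni := hno₁ s ⟨le_rfl, hsi⟩
  have htni := hno₂ t ⟨hit, le_rfl⟩
  have hleft : ∀ w : ℝ, (∀ᶠ u in 𝓝[<] i, v u = w) → w = v s := fun w hw => by
    obtain ⟨u, h1, h2⟩ := (hw.and (Ioo_mem_nhdsLT hsi)).exists
    rw [← h1]
    exact (hM.free_of_not_isImpact hs hi.2.le hno₁' (left_mem_Icc.2 hsi.le) hsni
      (Ioo_subset_Icc_self h2) (hno₁' u h2)).1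
  have hright : ∀ w : ℝ, (∀ᶠ u in 𝓝[>] i, v u = w) → w = v t := fun w hw => by
    obtain ⟨u, h1, h2⟩ := (hw.and (Ioo_mem_nhdsGT hit)).exists
    rw [← h1]
    exact (hM.free_of_not_isImpact hi.1.le ht hno₂' (right_mem_Icc.2 hit.le) htni
      (Ioo_subset_Icc_self h2) (hno₂' u h2)).1
  rcases himp with h | h
  · obtain ⟨v₁, v₂, h1, h2, h3⟩ := hM.impact_fixed i hi h
    left
    rw [← hleft v₁ h1, ← hright v₂ h2, h3, abs_neg]
    exact ⟨h, rfl⟩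
  · obtain ⟨v₁, v₂, h1, h2, h3⟩ := hM.impact_moving i hi h
    right
    rw [hleft v₁ h1, hright v₂ h2] at h3
    have hpos : 0 < v s := by
      by_contra hneg
      have hline := hM.eq_line hs hi.2.le hsi hno₁' (left_mem_Icc.2 hsi.le) hsni i
        (right_mem_Icc.2 hsi.le)
      have hwall := (hM.mem_walls s ⟨hs, hsi.le.trans hi.2.le⟩).2
      rw [abs_of_nonpos (not_lt.1 hneg)] at hslow
      linarith
    rw [abs_of_pos hpos] at hslow' ⊢
    have hneg : v t < 0 := by linarith
    refine ⟨h, hpos, hneg, ?_⟩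
    rw [abs_of_neg hneg]
    linarith

end motion

/-! ### The improved variables along a motion with impacts -/

/-- At an impact the improved action and the improved phase do not jump: the jump of the action is
compensated by that of the phase derivative of the generating function. -/
theorem action_eq_of_impact {d : ℝ → ℝ} (hd : ContDiff ℝ ∞ d) (hd0 : ∀ τ, d τ ≠ 0) (n : ℕ)
    {ε y w₁ w₂ t J : ℝ}
    (himp : (y = 0 ∧ |w₂| = |w₁|) ∨
      (y = d (ε * t) ∧ 0 < w₁ ∧ w₂ < 0 ∧ |w₂| = |w₁| - 2 * (ε * deriv d (ε * t))))
    (h : d (ε * t) * |w₁| / π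
      = J + ε * dx (stage d (n + 1)).gen (ε / J) (flightPhase d ε w₁ y t) (ε * t)) :
    d (ε * t) * |w₂| / π
        = J + ε * dx (stage d (n + 1)).gen (ε / J) (flightPhase d ε w₂ y t) (ε * t) ∧
      phaseCorr d (n + 1) ε J (flightPhase d ε w₂ y t) (ε * t)
        = phaseCorr d (n + 1) ε J (flightPhase d ε w₁ y t) (ε * t) := by
  rcases himp with ⟨rfl, hw⟩ | ⟨rfl, h₁, h₂, hw⟩
  · have h0 : ∀ w, flightPhase d ε w 0 t = 0 := fun w => by simp [flightPhase]
    rw [h0] at h ⊢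
    rw [hw, h0]
    exact ⟨h, rfl⟩
  · have hX₁ : flightPhase d ε w₁ (d (ε * t)) t = π := by
      rw [flightPhase, direction, if_pos h₁, div_self (hd0 _), mul_one, one_mul]
    have hX₂ : flightPhase d ε w₂ (d (ε * t)) t = -π := by
      rw [flightPhase, direction, if_neg h₂.not_gt, div_self (hd0 _), mul_one, neg_one_mul]
    rw [hX₁] at h ⊢
    rw [hX₂, hw]
    have hπ := Real.pi_pos
    constructor
    · rw [(stage_jump hd hd0 n (ε / J) (ε * t)).1] at h
      rw [mul_sub, sub_div, h]
      ring
    · have : ∀ z, dz (stage d (n + 1)).gen z (-π) (ε * t) = dz (stage d (n + 1)).gen z π (ε * t) :=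
        fun z => by simp only [dz, gen_pi hd hd0]
      rw [phaseCorr, phaseCorr, this]

section chain

variable {d : ℝ → ℝ} (hd : ContDiff ℝ ∞ d) {c : ℝ} (hc : 0 < c) (hdc : ∀ τ, c ≤ d τ)
include hd hc hdc

/-- The drift of the improved variables of stage `n + 1` along a motion with any number of
impacts. In the estimate of the phase, `g` is the frequency of the phase `ψ` of reference and `G`
bounds its difference from the frequency of the normal form. -/
theorem exists_chain {U : Set ℝ} (hU : IsBoundedOn d U) (n : ℕ) {a b : ℝ} (ha : 0 < a)
    (hab : a ≤ b) :
    ∃ ε₀ > 0, ∃ C > 0, ∀ ε ∈ Ioo 0 ε₀, ∀ L : ℝ, (∀ u ∈ Icc 0 L, ε * u ∈ U) →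
      C * ε ^ (n + 2) * L ≤ a / 8 →
      ∀ x v Φ : ℝ → ℝ, IsMotion d ε L x v → IsLiftedPhase d ε L x v Φ →
      ∀ t₀ ∈ Icc 0 L, ¬ IsImpact d ε x t₀ → action d ε v t₀ ∈ Icc a b →
      ∃ J₀ : ℝ, ∀ t ∈ Icc t₀ L, ¬ IsImpact d ε x t →
        action d ε v t ∈ Icc (a / 2) (2 * b) ∧
        ∃ J ∈ Ioo (action d ε v t / 2) (2 * action d ε v t),
          action d ε v t
            = J + ε * dx (stage d (n + 1)).gen (ε / J) (sawtooth (Φ t)) (ε * t) ∧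
          |J - J₀| ≤ C * ε ^ (n + 2) * (t - t₀) ∧
          ∀ (ψ g : ℝ → ℝ) (G : ℝ),
            (∀ u ∈ Icc t₀ L, HasDerivWithinAt ψ (g u) (Icc t₀ L) u) →
            (∀ u ∈ Icc t₀ L, ∀ K : ℝ, |K - J₀| ≤ C * ε ^ (n + 2) * (L - t₀) →
              |g u - K * scaledFreq d (n + 1) (ε / K) (ε * u)| ≤ G) →
            |Φ t - phaseCorr d (n + 1) ε J (sawtooth (Φ t)) (ε * t)
              - (Φ t₀ - phaseCorr d (n + 1) ε J₀ (sawtooth (Φ t₀)) (ε * t₀)) - (ψ t - ψ t₀)|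
              ≤ (C * ε ^ (n + 2) + G) * (t - t₀) := by
  have hπ := Real.pi_pos
  have hdpos : ∀ τ, 0 < d τ := fun τ => hc.trans_le (hdc τ)
  have hd0 : ∀ τ, d τ ≠ 0 := fun τ => (hdpos τ).ne'
  have hb : 0 < b := ha.trans_le hab
  obtain ⟨B, hB0, hB⟩ :=
    (PolyFun.coeff (self_mem_coeffAlgebra d)).exists_bound hc hdc hU
  obtain ⟨M, hM0, hM⟩ :=
    (PolyFun.coeff (deriv_self_mem_coeffAlgebra d)).exists_bound hc hdc hU
  -- The induction hypothesis bounds the action by `a / 2` and `2 * b` before the last impact, the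
  -- flight and the impact which follow lose a factor, and the closeness of `J` to `J₀` restores
  -- the bounds at the end.
  obtain ⟨ε₁, hε₁, C₁, hC₁, hfl₁⟩ := exists_flight hd hc hdc hU (n + 1) (α := a / 2)
    (β := 2 * b) (by positivity) (by positivity)
  obtain ⟨ε₂, hε₂, C₂, hC₂, hfl₂⟩ := exists_flight hd hc hdc hU (n + 1) (α := a / 8)
    (β := 8 * b) (by positivity) (by positivity)
  obtain ⟨ε₃, hε₃, K, hK, hsolve⟩ :=
    exists_solve hc hdc hU (polyFun_gen hd hd0 (n + 1)).dx (α := a / 16) (by positivity)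
  refine ⟨min (min ε₁ ε₂) (min ε₃ (min (a / (16 * K)) (min (a / (16 * B * M))
    (π * a / (4 * B * M))))), by positivity, C₁ + C₂, by positivity, ?_⟩
  intro ε hε L hmem hL x v Φ hMot hΦ t₀ ht₀ ht₀i hI₀
  have hε0 : 0 < ε := hε.1
  have he₁ : ε ∈ Ioo 0 ε₁ := ⟨hε0, hε.2.trans_le ((min_le_left _ _).trans (min_le_left _ _))⟩
  have he₂ : ε ∈ Ioo 0 ε₂ := ⟨hε0, hε.2.trans_le ((min_le_left _ _).trans (min_le_right _ _))⟩
  have he₃ : ε ∈ Ioo 0 ε₃ := ⟨hε0, hε.2.trans_le ((min_le_right _ _).trans (min_le_left _ _))⟩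
  have he₄ : K * ε ≤ a / 16 := by
    have h := (lt_div_iff₀ (by positivity)).1 (hε.2.trans_le ((min_le_right _ _).trans
      ((min_le_right _ _).trans (min_le_left _ _))))
    linarith
  have he₅ : B * (ε * M) ≤ a / 16 := by
    have h := (lt_div_iff₀ (by positivity)).1 (hε.2.trans_le ((min_le_right _ _).trans
      ((min_le_right _ _).trans ((min_le_right _ _).trans (min_le_left _ _)))))
    linarith
  have he₆ : ε * (4 * B * M) < π * a := (lt_div_iff₀ (by positivity)).1 (hε.2.trans_le
      ((min_le_right _ _).trans ((min_le_right _ _).trans ((min_le_right _ _).trans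
        (min_le_right _ _)))))
  set C := C₁ + C₂ with hC
  have hdB : ∀ u ∈ Icc 0 L, d (ε * u) ≤ B := fun u hu =>
    (le_abs_self _).trans (hB _ (hmem u hu) 0 0 (by simp [hπ.le]) (by simp))
  have hdM : ∀ u ∈ Icc 0 L, |ε * deriv d (ε * u)| ≤ ε * M := fun u hu => by
    rw [abs_mul, abs_of_pos hε0]
    exact mul_le_mul_of_nonneg_left (hM _ (hmem u hu) 0 0 (by simp [hπ.le]) (by simp)) hε0.le
  have hεn : 0 < ε ^ (n + 2) := by positivity
  have hsaw : ∀ t ∈ Icc 0 L, ¬ IsImpact d ε x t →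
      sawtooth (Φ t) = flightPhase d ε (v t) (x t) t := fun t ht hti =>
    IsLiftedPhase.sawtooth_eq hdpos hMot hΦ ht hti
  -- The improved action at the initial time.
  obtain ⟨J₀, hJ₀, hJ₀eq⟩ := (hsolve ε he₃ (ε * t₀) (hmem t₀ ht₀) (sawtooth (Φ t₀))
    (abs_sawtooth_le _)).2.2 (action d ε v t₀) (by linarith [hI₀.1])
  have hJ₀I : |action d ε v t₀ - J₀| ≤ a / 16 := by
    have h := (hsolve ε he₃ (ε * t₀) (hmem t₀ ht₀) (sawtooth (Φ t₀))
      (abs_sawtooth_le _)).2.1 J₀ (by linarith [hI₀.1, hJ₀.1])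
    rw [← add_sub_cancel_left J₀ (ε * _), ← hJ₀eq] at h
    exact h.trans he₄
  refine ⟨J₀, ?_⟩
  have hfin : ∀ t, {u | u ∈ Ioo t₀ t ∧ t ≤ L ∧ IsImpact d ε x u}.Finite := fun t =>
    hMot.finite_impacts.subset fun u hu =>
      ⟨⟨ht₀.1.trans hu.1.1.le, hu.1.2.le.trans hu.2.1⟩, hu.2.2⟩
  -- Induction on the number of impacts between `t₀` and `t`.
  intro t ht hti
  induction hN : {u | u ∈ Ioo t₀ t ∧ t ≤ L ∧ IsImpact d ε x u}.ncard
    using Nat.strong_induction_on generalizing t with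
  | _ N ih =>
  have ht0L : t ∈ Icc 0 L := ⟨ht₀.1.trans ht.1, ht.2⟩
  rcases ht.1.eq_or_lt with rfl | ht₀t
  · refine ⟨⟨by linarith [hI₀.1], by linarith [hI₀.2]⟩, J₀, hJ₀, hJ₀eq, by simp, ?_⟩
    intro ψ g G _ _
    simp
  -- The state at the beginning of the flight which contains `t`.
  obtain ⟨p, hp, hpno, Jp, hJp, hIp, hIpeq, hJpJ₀, hphase⟩ : ∃ p ∈ Ico t₀ t,
      (∀ u ∈ Ioo p t, ¬ IsImpact d ε x u) ∧ ∃ Jp ∈ Icc (a / 8 / 2) (2 * (8 * b)),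
      d (ε * p) * |v t| / π ∈ Icc (a / 8) (8 * b) ∧
      d (ε * p) * |v t| / π
        = Jp + ε * dx (stage d (n + 1)).gen (ε / Jp) (flightPhase d ε (v t) (x p) p) (ε * p) ∧
      |Jp - J₀| ≤ C * ε ^ (n + 2) * (p - t₀) ∧
      ∀ (ψ g : ℝ → ℝ) (G : ℝ), (∀ u ∈ Icc t₀ L, HasDerivWithinAt ψ (g u) (Icc t₀ L) u) →
        (∀ u ∈ Icc t₀ L, ∀ K : ℝ, |K - J₀| ≤ C * ε ^ (n + 2) * (L - t₀) →
          |g u - K * scaledFreq d (n + 1) (ε / K) (ε * u)| ≤ G) →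
        |Φ p - phaseCorr d (n + 1) ε Jp (flightPhase d ε (v t) (x p) p) (ε * p)
          - (Φ t₀ - phaseCorr d (n + 1) ε J₀ (sawtooth (Φ t₀)) (ε * t₀)) - (ψ p - ψ t₀)|
          ≤ (C * ε ^ (n + 2) + G) * (p - t₀) := by
    rcases eq_empty_or_nonempty {u | u ∈ Ioo t₀ t ∧ t ≤ L ∧ IsImpact d ε x u} with hemp | hne
    · have hno : ∀ u ∈ Ioo t₀ t, ¬ IsImpact d ε x u := fun u hu hui =>
        eq_empty_iff_forall_notMem.1 hemp u ⟨hu, ht.2, hui⟩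
      have hv : v t = v t₀ := (hMot.free_of_not_isImpact ht₀.1 ht.2 hno (left_mem_Icc.2 ht.1) ht₀i
        (right_mem_Icc.2 ht.1) hti).1
      rw [hsaw t₀ ht₀ ht₀i] at hJ₀eq ⊢
      refine ⟨t₀, ⟨le_rfl, ht₀t⟩, hno, J₀, ⟨by linarith [hJ₀.1, hI₀.1], by linarith [hJ₀.2, hI₀.2]⟩,
        ?_, ?_, by simp, ?_⟩
      · rw [hv]
        exact ⟨le_trans (by linarith) hI₀.1, le_trans hI₀.2 (by linarith)⟩
      · rw [hv]
        exact hJ₀eq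
      · intro ψ g G _ _
        rw [hv]
        simp
    · -- `i` is the last impact, and `s` a time during the flight before it.
      obtain ⟨i, ⟨hi, -, hii⟩, hlast⟩ := (hfin t).isCompact.exists_isGreatest hne
      have hno₂ : ∀ u ∈ Ioc i t, ¬ IsImpact d ε x u := by
        intro u hu hui
        rcases hu.2.eq_or_lt with rfl | h
        · exact hti hui
        · exact hu.1.not_ge (hlast ⟨⟨hi.1.trans hu.1, h⟩, ht.2, hui⟩)
      have hiL : i ≤ L := hi.2.le.trans ht.2
      obtain ⟨s, hs, hno₁⟩ : ∃ s ∈ Ioo t₀ i, ∀ u ∈ Ico s i, ¬ IsImpact d ε x u := by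
        obtain ⟨m, hm, hmlast⟩ := ((hfin i).insert t₀).isCompact.exists_isGreatest
          (insert_nonempty _ _)
        have hmi : t₀ ≤ m ∧ m < i := by
          rcases hm with rfl | hm
          · exact ⟨le_rfl, hi.1⟩
          · exact ⟨hm.1.1.le, hm.1.2⟩
        refine ⟨(m + i) / 2, ⟨by linarith, by linarith⟩, fun u hu hui => ?_⟩
        have h1 := hu.1
        have h2 : u ≤ m := hmlast (Or.inr ⟨⟨by linarith, hu.2⟩, hiL, hui⟩)
        linarith
      have hsni := hno₁ s ⟨le_rfl, hs.2⟩
      have hs0 : 0 ≤ s := ht₀.1.trans hs.1.le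
      have hsL : s ∈ Icc 0 L := ⟨hs0, hs.2.le.trans hiL⟩
      have hno₁' : ∀ u ∈ Ioo s i, ¬ IsImpact d ε x u := fun u hu => hno₁ u ⟨hu.1.le, hu.2⟩
      have hcard : {u | u ∈ Ioo t₀ s ∧ s ≤ L ∧ IsImpact d ε x u}.ncard < N := by
        rw [← hN]
        refine ncard_lt_ncard ⟨fun u hu => ⟨⟨hu.1.1, hu.1.2.trans (hs.2.trans hi.2)⟩, ht.2, hu.2.2⟩,
          fun h => ?_⟩ (hfin t)
        exact (h ⟨hi, ht.2, hii⟩ : i ∈ _ ∧ _).1.2.not_gt hs.2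
      obtain ⟨hIs, Js, hJs, hJseq, hJsJ₀, hphs⟩ := ih _ hcard s ⟨hs.1.le, hsL.2⟩ hsni rfl
      rw [hsaw s hsL hsni] at hJseq hphs
      have hsub : Icc s i ⊆ Icc 0 L := Icc_subset_Icc hs0 hiL
      have hsub' : Icc s i ⊆ Icc t₀ L := Icc_subset_Icc hs.1.le hiL
      obtain ⟨hIi, Ji, hJi, hJieq, hJiJs, hphi⟩ := hfl₁ ε he₁ s i hs.2.le
        (fun u hu => hmem u (hsub hu)) x (v s)
        (hMot.eq_line hs0 hiL hs.2 hno₁' (left_mem_Icc.2 hs.2.le) hsni)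
        (fun u hu => hMot.mem_walls u (hsub hu)) hIs Js
        ⟨by linarith [hIs.1, hJs.1], by linarith [hIs.2, hJs.2]⟩ hJseq
      -- The particle is much faster than the wall.
      have hvs : 2 * (ε * M) < |v s| := by
        have h1 : a / 2 ≤ d (ε * s) * |v s| / π := hIs.1
        rw [le_div_iff₀ hπ] at h1
        have h2 : d (ε * s) * |v s| ≤ B * |v s| :=
          mul_le_mul_of_nonneg_right (hdB s hsL) (abs_nonneg _)
        refine lt_of_mul_lt_mul_left (a := B) ?_ hB0.le
        linarith
      have hiM := abs_le.1 (hdM i ⟨hs0.trans hs.2.le, hiL⟩)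
      have himp := hMot.impact hs0 hs.2 hi.2 ht.2 hno₁ hno₂ hii (by
        have hder : ∀ u ∈ Icc s i, HasDerivWithinAt (fun u => d (ε * u)) (ε * deriv d (ε * u))
            (Icc s i) u := fun u _ => by
          have h1 : HasDerivAt (fun u => ε * u) (ε * 1) u := (hasDerivAt_id u).const_mul ε
          have h2 := ((hd.differentiable (by simp) (ε * u)).hasDerivAt).comp u h1
          exact (h2.congr_deriv (by ring)).hasDerivWithinAt
        have h := norm_image_sub_le_of_norm_deriv_le_segment' hder
          (fun u hu => hdM u (hsub (Ico_subset_Icc_self hu))) i (right_mem_Icc.2 hs.2.le)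
        have h1 := (abs_le.1 h).1
        have h2 : ε * M * (i - s) < |v s| * (i - s) :=
          mul_lt_mul_of_pos_right (by linarith [mul_pos hε0 hM0]) (sub_pos.2 hs.2)
        linarith) (by linarith)
      obtain ⟨hJteq, hcorr⟩ := action_eq_of_impact hd hd0 n himp hJieq
      have hIjump : |d (ε * i) * |v t| / π - d (ε * i) * |v s| / π| ≤ a / 8 := by
        have h1 : |(|v t| - |v s|)| ≤ 2 * (ε * M) := by
          rcases himp with ⟨-, h⟩ | ⟨-, -, -, h⟩
          · rw [h, sub_self, abs_zero]
            positivity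
          · rw [h, abs_le]
            constructor <;> linarith
        rw [← sub_div, ← mul_sub, abs_div, abs_mul, abs_of_pos (hdpos _), abs_of_pos hπ,
          div_le_iff₀ hπ]
        have h2 : d (ε * i) * |(|v t| - |v s|)| ≤ B * (2 * (ε * M)) := by
          gcongr
          exact hdB i ⟨hs0.trans hs.2.le, hiL⟩
        have h3 : a / 8 * 1 ≤ a / 8 * π := by
          gcongr
          linarith [Real.pi_gt_three]
        linarith
      have hj := abs_le.1 hIjump
      have hit : 0 ≤ i - s := sub_nonneg.2 hs.2.le
      have hJiJ₀ : |Ji - J₀| ≤ C * ε ^ (n + 2) * (i - t₀) := by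
        have h1 := abs_sub_le Ji Js J₀
        have h2 : C₁ * ε ^ (n + 2) * (i - s) ≤ C * ε ^ (n + 2) * (i - s) := by
          gcongr
          linarith
        have h3 : |Ji - Js| ≤ C₁ * ε ^ (n + 2) * (i - s) := hJiJs
        linarith
      refine ⟨i, ⟨hi.1.le, hi.2⟩, fun u hu => hno₂ u ⟨hu.1, hu.2.le⟩, Ji,
        ⟨by linarith [hIi.1, hJi.1], by linarith [hIi.2, hJi.2]⟩,
        ⟨by linarith [hIi.1], by linarith [hIi.2]⟩, hJteq, hJiJ₀, fun ψ g G hψ hg => ?_⟩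
      have h1 := hphs ψ g G hψ hg
      have h2 := hphi ψ g G (fun u hu => (hψ u (hsub' hu)).mono hsub')
        (fun u hu => hg u (hsub' hu) Js (hJsJ₀.trans (by
          gcongr
          exact hsL.2)))
      have h3 := IsLiftedPhase.sub_eq hd.continuous hd0 hMot hΦ hs0 hiL hs.2.le hno₁'
        (left_mem_Icc.2 hs.2.le) hsni
      have h4 : (C₁ * ε ^ (n + 2) + G) * (i - s) ≤ (C * ε ^ (n + 2) + G) * (i - s) := by
        gcongr
        linarith
      rw [hcorr]
      have h5 := (abs_add_le _ _).trans (add_le_add h1 (h2.trans h4))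
      refine (le_of_eq ?_).trans (h5.trans (le_of_eq (by ring)))
      congr 1
      linear_combination h3
  -- The flight which ends at `t`.
  have hp0 : 0 ≤ p := ht₀.1.trans hp.1
  have hsub : Icc p t ⊆ Icc 0 L := Icc_subset_Icc hp0 ht.2
  have hsub' : Icc p t ⊆ Icc t₀ L := Icc_subset_Icc hp.1 ht.2
  have hline := hMot.eq_line hp0 ht.2 hp.2 hpno (right_mem_Icc.2 hp.2.le) hti
  obtain ⟨hIt, J, hJ, hJeq, hJJp, hph⟩ := hfl₂ ε he₂ p t hp.2.le
    (fun u hu => hmem u (hsub hu)) x (v t)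
    (fun u hu => by
      rw [hline u hu, hline p (left_mem_Icc.2 hp.2.le)]
      ring)
    (fun u hu => hMot.mem_walls u (hsub hu)) hIp Jp hJp hIpeq
  have htp : 0 ≤ t - p := sub_nonneg.2 hp.2.le
  have hC₂' : C₂ * ε ^ (n + 2) * (t - p) ≤ C * ε ^ (n + 2) * (t - p) := by
    gcongr
    linarith
  have hJJ₀ : |J - J₀| ≤ C * ε ^ (n + 2) * (t - t₀) := by
    have h1 := abs_sub_le J Jp J₀
    have h3 : |J - Jp| ≤ C₂ * ε ^ (n + 2) * (t - p) := hJJp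
    linarith
  have hJ₀' := abs_le.1 hJ₀I
  have hJa : |J - J₀| ≤ a / 8 := by
    refine hJJ₀.trans (le_trans ?_ hL)
    gcongr
    linarith [ht₀.1, ht.2]
  have hJa' := abs_le.1 hJa
  have hIJ : |action d ε v t - J| ≤ a / 16 := by
    have h := (hsolve ε he₃ (ε * t) (hmem t ht0L) _
      (abs_flightPhase_le (w := v t) (hdpos _) (hMot.mem_walls t ht0L))).2.1 J
      (by linarith [hJ.1, hIt.1])
    rw [← add_sub_cancel_left J (ε * _), ← hJeq] at h
    exact h.trans he₄
  have hIJ' := abs_le.1 hIJ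
  refine ⟨⟨by linarith [hI₀.1], by linarith [hI₀.2]⟩, J, hJ, ?_, hJJ₀, fun ψ g G hψ hg => ?_⟩
  · rw [hsaw t ht0L hti]
    exact hJeq
  · have h1 := hphase ψ g G hψ hg
    have h2 := hph ψ g G (fun u hu => (hψ u (hsub' hu)).mono hsub')
      (fun u hu => hg u (hsub' hu) Jp (hJpJ₀.trans (by
        gcongr
        exact hp.2.le.trans ht.2)))
    have h3 := IsLiftedPhase.sub_eq hd.continuous hd0 hMot hΦ hp0 ht.2 hp.2.le hpno
      (right_mem_Icc.2 hp.2.le) hti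
    have h4 : (C₂ * ε ^ (n + 2) + G) * (t - p) ≤ (C * ε ^ (n + 2) + G) * (t - p) := by
      gcongr
      linarith
    rw [hsaw t ht0L hti]
    have h5 := (abs_add_le _ _).trans (add_le_add h1 (h2.trans h4))
    refine (le_of_eq ?_).trans (h5.trans (le_of_eq (by ring)))
    congr 1
    linear_combination h3

end chain

/-! ### Comparison of normal forms of different orders -/

section compare

variable {d : ℝ → ℝ} (hd : ContDiff ℝ ∞ d)
include hd

/-- Later stages change the generating function only from order `n` in `z` on. -/
theorem exists_gen_add (hd0 : ∀ τ, d τ ≠ 0) (n j : ℕ) :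
    ∃ F, PolyFun d F ∧ ∀ z x τ,
      (stage d (n + j)).gen z x τ = (stage d n).gen z x τ + z ^ n * F z x τ := by
  induction j with
  | zero => exact ⟨_, PolyFun.const 0, fun z x τ => by simp⟩
  | succ j ih =>
    obtain ⟨F, hF, h⟩ := ih
    refine ⟨_, hF.add _ _ ((PolyFun.z_var.pow j).mul
      (polyFun_corrGen (polyFun_rem hd hd0 (n + j)))), fun z x τ => ?_⟩
    rw [← add_assoc]
    simp only [stage]
    rw [h, pow_add]
    ring

/-- Later stages change the new Hamiltonian only from order `n + 1` in `z` on. -/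
theorem exists_ham_add (hd0 : ∀ τ, d τ ≠ 0) (n j : ℕ) :
    ∃ F, PolyFun d F ∧ ∀ z x τ,
      (stage d (n + j)).ham z τ = (stage d n).ham z τ + z ^ (n + 1) * F z x τ := by
  induction j with
  | zero => exact ⟨_, PolyFun.const 0, fun z x τ => by simp⟩
  | succ j ih =>
    obtain ⟨F, hF, h⟩ := ih
    refine ⟨_, hF.add _ _ ((PolyFun.z_var.pow j).mul
      (polyFun_corrHam (polyFun_rem hd hd0 (n + j)))), fun z x τ => ?_⟩
    rw [← add_assoc]
    simp only [stage]
    rw [h z x τ]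
    ring

theorem polyFun_scaledFreq (hd0 : ∀ τ, d τ ≠ 0) (n : ℕ) :
    PolyFun d (fun z _ τ => scaledFreq d n z τ) := by
  have hh := polyFun_ham hd hd0 n
  exact (((PolyFun.const _).mul ((PolyFun.coeff (inv_mem_coeffAlgebra d)).pow 2)).add _ _
    ((PolyFun.const 2).mul hh)).sub (PolyFun.z_var.mul hh.dz)

theorem exists_scaledFreq_add (hd0 : ∀ τ, d τ ≠ 0) (n j : ℕ) :
    ∃ F, PolyFun d F ∧ ∀ z x τ,
      scaledFreq d (n + j) z τ = scaledFreq d n z τ + z ^ (n + 1) * F z x τ := by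
  obtain ⟨F, hF, h⟩ := exists_ham_add hd hd0 n j
  refine ⟨_, ((PolyFun.const (1 - n : ℝ)).mul hF).sub (PolyFun.z_var.mul hF.dz),
    fun z x τ => ?_⟩
  have h1 : deriv (fun y => (stage d (n + j)).ham y τ) z
      = deriv (fun y => (stage d n).ham y τ) z
        + ((n + 1 : ℕ) * z ^ n * F z x τ + z ^ (n + 1) * dz F z x τ) := by
    simp only [h _ x τ]
    exact (((polyFun_ham hd hd0 n).hasDerivAt_z z x τ).add
      ((hasDerivAt_pow (n + 1) z).mul (hF.hasDerivAt_z z x τ))).deriv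
  rw [scaledFreq, scaledFreq, h1, h z x τ]
  push_cast
  ring

variable {c : ℝ} (hc : 0 < c) (hdc : ∀ τ, c ≤ d τ)
include hc hdc

/-- The improved variables of stages `n` and `n + j` differ by `O(ε ^ (n + 1))`. -/
theorem exists_compare {U : Set ℝ} (hU : IsBoundedOn d U) (n j : ℕ) {α : ℝ} (hα : 0 < α) :
    ∃ ε₀ > 0, ∃ C > 0, ∀ ε ∈ Ioo 0 ε₀, ∀ τ ∈ U, ∀ X : ℝ, |X| ≤ π → ∀ I, α ≤ I →
      ∃ J, {J | J ∈ Ioo (I / 2) (2 * I) ∧ I = J + ε * dx (stage d n).gen (ε / J) X τ} = {J} ∧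
        ∀ K, α / 2 ≤ K → I = K + ε * dx (stage d (n + j)).gen (ε / K) X τ →
          |J - K| ≤ C * ε ^ (n + 1) ∧
          |phaseCorr d n ε J X τ - phaseCorr d (n + j) ε K X τ| ≤ C * ε ^ (n + 1) := by
  have hd0 : ∀ τ, d τ ≠ 0 := fun τ => (hc.trans_le (hdc τ)).ne'
  have hg := polyFun_gen hd hd0 n
  obtain ⟨F, hF, hgen⟩ := exists_gen_add hd hd0 n j
  obtain ⟨M, hM0, hM⟩ := hF.dx.exists_bound hc hdc hU
  obtain ⟨N, hN0, hN⟩ := (((PolyFun.const (n : ℝ)).mul hF).add _ _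
    (PolyFun.z_var.mul hF.dz)).exists_bound hc hdc hU
  obtain ⟨P, hP0, hP⟩ := exists_phaseCorr_lipschitz hd hc hdc hU n (α := α / 2) (by positivity)
  obtain ⟨ε₁, hε₁, Q, hQ, hsolve⟩ := exists_solve hc hdc hU hg.dx hα
  set s := (α / 2)⁻¹ with hs
  have hs0 : 0 < s := by positivity
  refine ⟨min ε₁ (α / 2), by positivity,
    2 * (s ^ n * M) + (P * (2 * (s ^ n * M)) + s ^ (n + 1) * N), by positivity, ?_⟩
  intro ε hε τ hτ X hX I hI
  have hε0 : 0 < ε := hε.1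
  have he₁ : ε ∈ Ioo 0 ε₁ := ⟨hε0, hε.2.trans_le (min_le_left _ _)⟩
  have he₂ : ε < α / 2 := hε.2.trans_le (min_le_right _ _)
  obtain ⟨hinj, -, hex⟩ := hsolve ε he₁ τ hτ X hX
  obtain ⟨J, hJ, hJeq⟩ := hex I hI
  have hJα : α / 2 ≤ J := by linarith [hJ.1]
  refine ⟨J, Subset.antisymm ?_ (singleton_subset_iff.2 ⟨hJ, hJeq⟩), fun K hK hKeq => ?_⟩
  · rintro J' ⟨hJ', hJ'eq⟩
    have h := hinj J' J (by linarith [hJ'.1]) hJα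
    rw [← hJ'eq, ← hJeq, sub_self, abs_zero, mul_zero] at h
    exact sub_eq_zero.1 (abs_nonpos_iff.1 h)
  · have hK0 : 0 < K := by linarith
    have hz0 : 0 < ε / K := by positivity
    have hz1 : |ε / K| ≤ 1 := by
      rw [abs_of_pos hz0, div_le_one hK0]
      linarith
    have hzs : ε / K ≤ s * ε := by
      rw [div_eq_mul_inv, mul_comm]
      exact mul_le_mul_of_nonneg_right (inv_anti₀ (by positivity) hK) hε0.le
    have hdx : dx (stage d (n + j)).gen (ε / K) X τ
        = dx (stage d n).gen (ε / K) X τ + (ε / K) ^ n * dx F (ε / K) X τ := by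
      simp only [dx, hgen]
      exact ((hg.hasDerivAt_x (ε / K) X τ).add
        ((hF.hasDerivAt_x (ε / K) X τ).const_mul _)).deriv
    have hdz : dz (stage d (n + j)).gen (ε / K) X τ
        = dz (stage d n).gen (ε / K) X τ + (n * (ε / K) ^ (n - 1) * F (ε / K) X τ
          + (ε / K) ^ n * dz F (ε / K) X τ) := by
      simp only [dz, hgen]
      exact ((hg.hasDerivAt_z (ε / K) X τ).add
        ((hasDerivAt_pow n (ε / K)).mul (hF.hasDerivAt_z (ε / K) X τ))).deriv
    have h1 : |J - K| ≤ 2 * (s ^ n * M) * ε ^ (n + 1) := by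
      have h := hinj J K hJα hK
      rw [← hJeq, hKeq, hdx, show K + ε * (dx (stage d n).gen (ε / K) X τ
        + (ε / K) ^ n * dx F (ε / K) X τ) - (K + ε * dx (stage d n).gen (ε / K) X τ)
        = ε * ((ε / K) ^ n * dx F (ε / K) X τ) by ring, abs_mul, abs_mul, abs_of_pos hε0,
        abs_of_pos (pow_pos hz0 n)] at h
      calc |J - K| ≤ 2 * (ε * ((ε / K) ^ n * |dx F (ε / K) X τ|)) := h
        _ ≤ 2 * (ε * ((s * ε) ^ n * M)) := by
            gcongr
            exact hM τ hτ X _ hX hz1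
        _ = 2 * (s ^ n * M) * ε ^ (n + 1) := by ring
    have hεn : 0 < ε ^ (n + 1) := by positivity
    constructor
    · refine h1.trans (mul_le_mul_of_nonneg_right ?_ hεn.le)
      have : 0 < P * (2 * (s ^ n * M)) + s ^ (n + 1) * N := by positivity
      linarith
    · have h2 := hP ε ⟨hε0, he₂⟩ τ hτ X hX J K hJα hK
      have h3 : phaseCorr d (n + j) ε K X τ = phaseCorr d n ε K X τ
          + (ε / K) ^ (n + 1) * (n * F (ε / K) X τ + ε / K * dz F (ε / K) X τ) := by
        rw [phaseCorr, phaseCorr, hdz]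
        rcases n with _ | n
        · simp
          ring
        · rw [Nat.add_sub_cancel]
          ring
      have h4 : |(ε / K) ^ (n + 1) * (n * F (ε / K) X τ + ε / K * dz F (ε / K) X τ)|
          ≤ s ^ (n + 1) * N * ε ^ (n + 1) := by
        rw [abs_mul, abs_of_pos (pow_pos hz0 _)]
        calc _ ≤ (s * ε) ^ (n + 1) * N := by
              gcongr
              exact hN τ hτ X _ hX hz1
          _ = s ^ (n + 1) * N * ε ^ (n + 1) := by ring
      have h5 : P * |J - K| ≤ P * (2 * (s ^ n * M) * ε ^ (n + 1)) := by gcongr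
      have h6 := abs_sub (phaseCorr d n ε J X τ - phaseCorr d n ε K X τ)
        ((ε / K) ^ (n + 1) * (n * F (ε / K) X τ + ε / K * dz F (ε / K) X τ))
      have h7 : 0 ≤ 2 * (s ^ n * M) * ε ^ (n + 1) := by positivity
      rw [h3, ← sub_sub]
      linarith

/-- The frequencies of the normal forms of stages `n` and `n + j`, at the actions `J` and `K`. -/
theorem exists_compare_freq {U : Set ℝ} (hU : IsBoundedOn d U) (n j : ℕ) {α : ℝ} (hα : 0 < α) :
    ∃ C > 0, ∀ ε ∈ Ioo 0 α, ∀ τ ∈ U, ∀ J K, α ≤ J → α ≤ K →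
      |J * scaledFreq d n (ε / J) τ - K * scaledFreq d (n + j) (ε / K) τ|
        ≤ C * (|J - K| + ε ^ (n + 1)) := by
  have hd0 : ∀ τ, d τ ≠ 0 := fun τ => (hc.trans_le (hdc τ)).ne'
  obtain ⟨F, hF, hfreq⟩ := exists_scaledFreq_add hd hd0 n j
  obtain ⟨M, hM0, hM⟩ := hF.exists_bound hc hdc hU
  obtain ⟨N, hN0, hN⟩ := (polyFun_scaledFreq hd hd0 n).exists_bound hc hdc hU
  obtain ⟨P, hP0, hP⟩ := (polyFun_scaledFreq hd hd0 n).exists_lipschitz hc hdc hU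
  set s := α⁻¹ with hs
  have hs0 : 0 < s := by positivity
  refine ⟨N + P + s ^ n * M, by positivity, fun ε hε τ hτ J K hJ hK => ?_⟩
  have hε0 : 0 < ε := hε.1
  have hJ0 : 0 < J := hα.trans_le hJ
  have hK0 : 0 < K := hα.trans_le hK
  have hz : ∀ J, α ≤ J → |ε / J| ≤ 1 := fun J hJ => by
    have hJ0 : 0 < J := hα.trans_le hJ
    rw [abs_of_pos (by positivity), div_le_one hJ0]
    exact hε.2.le.trans hJ
  have h0 : |(0 : ℝ)| ≤ π := by simp [Real.pi_pos.le]
  have h1 : |(J - K) * scaledFreq d n (ε / J) τ| ≤ N * |J - K| := by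
    rw [abs_mul, mul_comm]
    gcongr
    exact hN τ hτ 0 _ h0 (hz J hJ)
  have h2 : |K * (scaledFreq d n (ε / J) τ - scaledFreq d n (ε / K) τ)| ≤ P * |J - K| := by
    have h := hP τ hτ 0 _ _ h0 (hz J hJ) (hz K hK)
    have he : K * (ε / J - ε / K) = -(ε / J * (J - K)) := by
      field_simp
      ring
    calc |K * (scaledFreq d n (ε / J) τ - scaledFreq d n (ε / K) τ)|
        ≤ K * (P * |ε / J - ε / K|) := by
          rw [abs_mul, abs_of_pos hK0]
          gcongr
      _ = P * |K * (ε / J - ε / K)| := by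
          rw [abs_mul, abs_of_pos hK0]
          ring
      _ ≤ P * |J - K| := by
          rw [he, abs_neg, abs_mul]
          gcongr
          exact mul_le_of_le_one_left (abs_nonneg _) (hz J hJ)
  have h3 : |K * ((ε / K) ^ (n + 1) * F (ε / K) 0 τ)| ≤ s ^ n * M * ε ^ (n + 1) := by
    have hz0 : 0 < ε / K := by positivity
    have he : K * ((ε / K) ^ (n + 1) * F (ε / K) 0 τ) = ε * ((ε / K) ^ n * F (ε / K) 0 τ) := by
      rw [pow_succ]
      field_simp
    have hzs : ε / K ≤ s * ε := by
      rw [div_eq_mul_inv, mul_comm]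
      exact mul_le_mul_of_nonneg_right (inv_anti₀ (by positivity) hK) hε0.le
    rw [he, abs_mul, abs_mul, abs_of_pos hε0, abs_of_pos (pow_pos hz0 n)]
    calc _ ≤ ε * ((s * ε) ^ n * M) := by
          gcongr
          exact hM τ hτ 0 _ h0 (hz K hK)
      _ = s ^ n * M * ε ^ (n + 1) := by ring
  have h4 : J * scaledFreq d n (ε / J) τ - K * scaledFreq d (n + j) (ε / K) τ
      = (J - K) * scaledFreq d n (ε / J) τ
        + K * (scaledFreq d n (ε / J) τ - scaledFreq d n (ε / K) τ)
        - K * ((ε / K) ^ (n + 1) * F (ε / K) 0 τ) := by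
    rw [hfreq (ε / K) 0 τ]
    ring
  rw [h4]
  have h5 := abs_sub ((J - K) * scaledFreq d n (ε / J) τ
        + K * (scaledFreq d n (ε / J) τ - scaledFreq d n (ε / K) τ))
        (K * ((ε / K) ^ (n + 1) * F (ε / K) 0 τ))
  have h6 := abs_add_le ((J - K) * scaledFreq d n (ε / J) τ)
    (K * (scaledFreq d n (ε / J) τ - scaledFreq d n (ε / K) τ))
  have h7 : 0 ≤ s ^ n * M * |J - K| := by positivity
  have h8 : 0 ≤ (N + P) * ε ^ (n + 1) := by positivity
  linarith

end compare

/-! ### The improved variables of an arbitrary normal form -/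

section arbitrary

variable {d : ℝ → ℝ} (hd : ContDiff ℝ ∞ d) (hd0 : ∀ τ, d τ ≠ 0) {n : ℕ}
  {S : ℕ → ℝ → ℝ → ℝ → ℝ} {h : ℕ → ℝ → ℝ → ℝ} (H : IsNormalForm d (n + 1) S h)
include hd hd0 H

theorem IsNormalForm.genS_eq {ε J φ τ : ℝ} (hJ : 0 < J) :
    genS (n + 1) S ε J φ τ = (stage d n).gen (ε / J) (sawtooth φ) τ := by
  rw [← genS_canonS, genS, genS]
  refine Finset.sum_congr rfl fun i hi => ?_
  rw [(H.eq_of_isNormalForm hd0 (isNormalForm_canon hd hd0 (by omega)) i hi).2 J hJ]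

theorem IsNormalForm.sumH_eq {ε J τ : ℝ} (hJ : 0 < J) :
    sumH d (n + 1) h ε J τ
      = J ^ 2 * (π ^ 2 * (d τ)⁻¹ ^ 2 / 2 + (stage d n).ham (ε / J) τ) := by
  rw [← sumH_canonH, sumH, sumH]
  congr 1
  refine Finset.sum_congr rfl fun i hi => ?_
  rw [(H.eq_of_isNormalForm hd0 (isNormalForm_canon hd hd0 (by omega)) i hi).1 J hJ]

theorem IsNormalForm.isImprovedAction_iff {ε τ φ I J : ℝ} (hφ : ∀ n : ℤ, φ ≠ π + 2 * π * n)
    (hI : 0 < I) : IsImprovedAction (n + 1) S ε τ φ I J ↔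
      J ∈ Ioo (I / 2) (2 * I) ∧ I = J + ε * dx (stage d n).gen (ε / J) (sawtooth φ) τ := by
  refine and_congr_right fun hJ => ?_
  have hJ0 : 0 < J := (half_pos hI).trans hJ.1
  have h1 := (hasDerivAt_genS_canonS hd hd0 n ε J τ hφ).deriv
  simp only [genS_canonS] at h1
  simp only [H.genS_eq hd hd0 hJ0, h1]

theorem IsNormalForm.improvedPhase_eq {ε τ φ J : ℝ} (hJ : 0 < J) :
    improvedPhase (n + 1) S ε τ J φ = φ - phaseCorr d n ε J (sawtooth φ) τ := by
  have h1 : (fun K => genS (n + 1) S ε K φ τ)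
      =ᶠ[𝓝 J] fun K => (stage d n).gen (ε / K) (sawtooth φ) τ := by
    filter_upwards [Ioi_mem_nhds hJ] with K hK
    exact H.genS_eq hd hd0 hK
  have h2 : HasDerivAt (fun K => ε / K) (-ε / J ^ 2) J := by
    have := (hasDerivAt_const J ε).div (hasDerivAt_id J) hJ.ne'
    exact this.congr_deriv (by simp)
  have h3 := ((polyFun_gen hd hd0 n).hasDerivAt_z (ε / J) (sawtooth φ) τ).comp J h2
  rw [improvedPhase, h1.deriv_eq, phaseCorr]
  have h4 := h3.deriv
  simp only [Function.comp_def] at h4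
  rw [h4]
  field_simp
  ring

theorem IsNormalForm.deriv_sumH {ε τ J : ℝ} (hJ : 0 < J) :
    deriv (fun K => sumH d (n + 1) h ε K τ) J = J * scaledFreq d n (ε / J) τ := by
  have h1 : (fun K => sumH d (n + 1) h ε K τ)
      =ᶠ[𝓝 J] fun K => K ^ 2 * (π ^ 2 * (d τ)⁻¹ ^ 2 / 2 + (stage d n).ham (ε / K) τ) := by
    filter_upwards [Ioi_mem_nhds hJ] with K hK
    exact H.sumH_eq hd hd0 hK
  have h2 : HasDerivAt (fun K => ε / K) (-ε / J ^ 2) J := by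
    have := (hasDerivAt_const J ε).div (hasDerivAt_id J) hJ.ne'
    exact this.congr_deriv (by simp)
  have h3 := ((polyFun_ham hd hd0 n).hasDerivAt_z (ε / J) 0 τ).comp J h2
  have h4 := (hasDerivAt_pow 2 J).mul (h3.const_add (π ^ 2 * (d τ)⁻¹ ^ 2 / 2))
  have h5 : dz (fun z _ τ => (stage d n).ham z τ) (ε / J) 0 τ
      = deriv (fun y => (stage d n).ham y τ) (ε / J) := rfl
  rw [h1.deriv_eq, scaledFreq]
  refine HasDerivAt.deriv (h4.congr_deriv ?_)
  rw [h5]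
  simp only [Function.comp_apply]
  field_simp
  ring

end arbitrary

end

end FermiUlam

/-! ### Adiabatic invariance over long times -/

/-- The slow time stays in an interval on which all derivatives of `d` are bounded: a compact one if
`k ≤ 1`, and the whole line under the hypothesis made for `k ≥ 2`. -/
theorem FermiUlam.exists_isBoundedOn {d : ℝ → ℝ} (hd : ContDiff ℝ ∞ d) {k : ℕ}
    (hbdd : 2 ≤ k → ∀ n : ℕ, ∃ M : ℝ, ∀ τ, |iteratedDeriv n d τ| ≤ M) {T : ℝ} (hT : 0 < T) :
    ∃ U, FermiUlam.IsBoundedOn d U ∧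
      ∀ ε ∈ Ioo (0 : ℝ) 1, ∀ L ≤ T / ε ^ k, ∀ u ∈ Icc 0 L, ε * u ∈ U := by
  by_cases hk : 2 ≤ k
  · refine ⟨univ, fun n => ?_, fun _ _ _ _ _ _ => mem_univ _⟩
    obtain ⟨M, hM⟩ := hbdd hk n
    exact ⟨M, fun τ _ => hM τ⟩
  · refine ⟨Icc 0 T, fun n => ?_, fun ε hε L hL u hu => ?_⟩
    · have hc : Continuous (iteratedDeriv n d) :=
        hd.continuous_iteratedDeriv n (by exact_mod_cast le_top)
      obtain ⟨M, hM⟩ := isCompact_Icc.exists_bound_of_continuousOn (s := Icc 0 T) hc.continuousOn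
      exact ⟨M, hM⟩
    · have hε0 : 0 < ε := hε.1
      refine ⟨mul_nonneg hε0.le hu.1, ?_⟩
      have hpow : ε ≤ ε ^ k := by
        simpa using pow_le_pow_of_le_one hε0.le hε.2.le (show k ≤ 1 by omega)
      calc ε * u ≤ ε ^ k * (T / ε ^ k) := by
            gcongr
            · exact hu.1
            · exact hu.2.trans hL
        _ = T := by field_simp

theorem mainTheorem1
    (d : ℝ → ℝ) (hd : ContDiff ℝ ∞ d)
    (c : ℝ) (hc : 0 < c) (hdc : ∀ τ, c ≤ d τ)
    (r k : ℕ) (hr : 1 ≤ r)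
    (hbdd : 2 ≤ k → ∀ n : ℕ, ∃ M : ℝ, ∀ τ, |iteratedDeriv n d τ| ≤ M) :
    (∃ S h, FermiUlam.IsNormalForm d r S h) ∧
    ∀ (S : ℕ → ℝ → ℝ → ℝ → ℝ) (h : ℕ → ℝ → ℝ → ℝ), FermiUlam.IsNormalForm d r S h →
      ∀ a b T : ℝ, 0 < a → 0 < T →
      ∃ ε₀ > 0, ∃ C > 0, ∀ ε ∈ Ioo (0 : ℝ) ε₀, ∀ L ≤ T / ε ^ k,
      ∀ x v Φ : ℝ → ℝ, FermiUlam.IsMotion d ε L x v → FermiUlam.IsLiftedPhase d ε L x v Φ →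
      ∀ t₀ ∈ Icc 0 L, ¬ FermiUlam.IsImpact d ε x t₀ →
        FermiUlam.action d ε v t₀ ∈ Icc a b →
        ∃ Ihat : ℝ → ℝ,
          (∀ t ∈ Icc t₀ L, ¬ FermiUlam.IsImpact d ε x t →
            {J | FermiUlam.IsImprovedAction r S ε (ε * t) (Φ t) (FermiUlam.action d ε v t) J}
                = {Ihat t} ∧
              |Ihat t - Ihat t₀| ≤ C * ε ^ r) ∧
          ∀ J ψ : ℝ → ℝ, FermiUlam.IsIntegrableSolution d r h ε t₀ L J ψ →
            J t₀ = Ihat t₀ →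
            ψ t₀ = FermiUlam.improvedPhase r S ε (ε * t₀) (Ihat t₀) (Φ t₀) →
            ∀ t ∈ Icc t₀ L, ¬ FermiUlam.IsImpact d ε x t →
              |FermiUlam.improvedPhase r S ε (ε * t) (Ihat t) (Φ t) - ψ t|
                ≤ C * ε ^ ((r : ℤ) - (k : ℤ)) := by
  have hdpos : ∀ τ, 0 < d τ := fun τ => hc.trans_le (hdc τ)
  have hd0 : ∀ τ, d τ ≠ 0 := fun τ => (hdpos τ).ne'
  refine ⟨⟨_, _, FermiUlam.isNormalForm_canon hd hd0 hr⟩, fun S h H a b T ha hT => ?_⟩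
  obtain ⟨n, rfl⟩ : ∃ n, r = n + 1 := ⟨r - 1, by omega⟩
  rcases lt_or_ge b a with hba | hab
  · exact ⟨1, one_pos, 1, one_pos, fun ε _ L _ x v Φ _ _ t₀ _ _ hI =>
      absurd (hI.1.trans hI.2) hba.not_ge⟩
  obtain ⟨U, hU, hmem⟩ := FermiUlam.exists_isBoundedOn hd hbdd hT
  -- The normal form of order `r + k + 1` controls the motion for times of order `ε ^ (-k)`.
  obtain ⟨ε₁, hε₁, C₁, hC₁, hchain⟩ := FermiUlam.exists_chain hd hc hdc hU (n + k) ha hab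
  obtain ⟨ε₂, hε₂, C₂, hC₂, hcomp⟩ :=
    FermiUlam.exists_compare hd hc hdc hU n (k + 1) (α := a / 2) (by positivity)
  obtain ⟨C₃, hC₃, hfreq⟩ :=
    FermiUlam.exists_compare_freq hd hc hdc hU n (k + 1) (α := a / 8) (by positivity)
  rw [← add_assoc] at hcomp hfreq
  -- `C₄ * ε ^ r` bounds the difference of the two frequencies along the motion.
  set C₄ := C₃ * (C₂ + C₁ * T + 1) with hC₄
  have hC₄0 : 0 < C₄ := by positivity
  refine ⟨min (min ε₁ ε₂) (min (min 1 (a / 8)) (a / (8 * (C₁ * T)))), by positivity,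
    2 * C₂ + C₁ * T + C₄ * T, by positivity, ?_⟩
  intro ε hε L hL x v Φ hMot hΦ t₀ ht₀ ht₀i hI₀
  have hε0 : 0 < ε := hε.1
  have he₁ : ε ∈ Ioo 0 ε₁ := ⟨hε0, hε.2.trans_le ((min_le_left _ _).trans (min_le_left _ _))⟩
  have he₂ : ε ∈ Ioo 0 ε₂ := ⟨hε0, hε.2.trans_le ((min_le_left _ _).trans (min_le_right _ _))⟩
  have he₃ : ε < 1 := hε.2.trans_le
    ((min_le_right _ _).trans ((min_le_left _ _).trans (min_le_left _ _)))
  have he₄ : ε ∈ Ioo 0 (a / 8) := ⟨hε0, hε.2.trans_le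
    ((min_le_right _ _).trans ((min_le_left _ _).trans (min_le_right _ _)))⟩
  have he₅ : ε * (8 * (C₁ * T)) < a :=
    (lt_div_iff₀ (by positivity)).1 (hε.2.trans_le ((min_le_right _ _).trans (min_le_right _ _)))
  have hmem' := hmem ε ⟨hε0, he₃⟩ L hL
  have hεk : 0 < ε ^ k := by positivity
  have hεn : 0 < ε ^ (n + 1) := by positivity
  have hlong : ∀ t, t ≤ L → C₁ * ε ^ (n + k + 2) * t ≤ C₁ * T * ε * ε ^ (n + 1) := fun t ht => by
    calc C₁ * ε ^ (n + k + 2) * t ≤ C₁ * ε ^ (n + k + 2) * (T / ε ^ k) := by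
          gcongr
          exact ht.trans hL
      _ = C₁ * T * ε * ε ^ (n + 1) := by
          rw [show n + k + 2 = k + (n + 2) by omega, pow_add]
          field_simp
          ring
  have hεn1 : ε ^ (n + 1) ≤ 1 := pow_le_one₀ hε0.le he₃.le
  have hdrift : C₁ * T * ε * ε ^ (n + 1) ≤ C₁ * T * ε ^ (n + 1) := by
    refine mul_le_mul_of_nonneg_right ?_ hεn.le
    exact mul_le_of_le_one_right (by positivity) he₃.le
  have hsmall : C₁ * T * ε * ε ^ (n + 1) ≤ a / 8 := by
    refine (mul_le_of_le_one_right (by positivity) hεn1).trans ?_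
    linarith
  -- `J₀` and, below, `K` are values of the improved action of order `n + k + 2`, that is
  -- `r + k + 1`; `J` and `Ihat` are values of the improved action of order `r = n + 1`.
  obtain ⟨J₀, hJ₀⟩ := hchain ε he₁ L hmem' ((hlong L le_rfl).trans hsmall) x v Φ hMot hΦ t₀ ht₀
    ht₀i hI₀
  have ht₀L : t₀ ∈ Icc t₀ L := ⟨le_rfl, ht₀.2⟩
  have hex : ∀ t, ∃ J, t ∈ Icc t₀ L → ¬ FermiUlam.IsImpact d ε x t →
      {J | FermiUlam.IsImprovedAction (n + 1) S ε (ε * t) (Φ t) (FermiUlam.action d ε v t) J}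
          = {J} ∧
      a / 4 ≤ J ∧ ∃ K, a / 4 ≤ K ∧ |J - K| ≤ C₂ * ε ^ (n + 1) ∧
        |FermiUlam.phaseCorr d n ε J (FermiUlam.sawtooth (Φ t)) (ε * t)
          - FermiUlam.phaseCorr d (n + k + 1) ε K (FermiUlam.sawtooth (Φ t)) (ε * t)|
            ≤ C₂ * ε ^ (n + 1) ∧
        |K - J₀| ≤ C₁ * ε ^ (n + k + 2) * (t - t₀) ∧
        ∀ (ψ g : ℝ → ℝ) (G : ℝ),
          (∀ u ∈ Icc t₀ L, HasDerivWithinAt ψ (g u) (Icc t₀ L) u) →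
          (∀ u ∈ Icc t₀ L, ∀ K : ℝ, |K - J₀| ≤ C₁ * ε ^ (n + k + 2) * (L - t₀) →
            |g u - K * FermiUlam.scaledFreq d (n + k + 1) (ε / K) (ε * u)| ≤ G) →
          |Φ t - FermiUlam.phaseCorr d (n + k + 1) ε K (FermiUlam.sawtooth (Φ t)) (ε * t)
            - (Φ t₀ - FermiUlam.phaseCorr d (n + k + 1) ε J₀ (FermiUlam.sawtooth (Φ t₀)) (ε * t₀))
            - (ψ t - ψ t₀)| ≤ (C₁ * ε ^ (n + k + 2) + G) * (t - t₀) := by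
    intro t
    by_cases h1 : t ∈ Icc t₀ L ∧ ¬ FermiUlam.IsImpact d ε x t
    · obtain ⟨ht, hti⟩ := h1
      have htL : t ∈ Icc 0 L := ⟨ht₀.1.trans ht.1, ht.2⟩
      obtain ⟨hI, K, hK, hKeq, hKJ₀, hphase⟩ := hJ₀ t ht hti
      obtain ⟨J, hJ, hJK⟩ := hcomp ε he₂ (ε * t) (hmem' t htL) (FermiUlam.sawtooth (Φ t))
        (FermiUlam.abs_sawtooth_le _) (FermiUlam.action d ε v t) hI.1
      have hJmem : J ∈ Ioo _ _ ∧ _ := hJ.symm.subset (mem_singleton J)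
      obtain ⟨hJ1, hJ2⟩ := hJK K (by linarith [hK.1, hI.1]) hKeq
      refine ⟨J, fun _ _ => ⟨?_, by linarith [hJmem.1.1, hI.1], K, by linarith [hK.1, hI.1], hJ1,
        hJ2, hKJ₀, hphase⟩⟩
      rw [← hJ]
      ext J'
      exact H.isImprovedAction_iff hd hd0 (hΦ.ne_pi hdpos hMot htL hti) (by linarith [hI.1])
    · exact ⟨0, fun ht hti => absurd ⟨ht, hti⟩ h1⟩
  choose Ihat hIhat using hex
  obtain ⟨-, h₀a, K₀, hK₀a, hIK₀, hcorr₀, hK₀, -⟩ := hIhat t₀ ht₀L ht₀i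
  obtain rfl : K₀ = J₀ := by
    rw [sub_self, mul_zero] at hK₀
    exact sub_eq_zero.1 (abs_nonpos_iff.1 hK₀)
  refine ⟨Ihat, fun t ht hti => ?_, fun J ψ hsol hJt₀ hψt₀ t ht hti => ?_⟩
  · obtain ⟨hset, -, K, -, hIK, -, hKK₀, -⟩ := hIhat t ht hti
    refine ⟨hset, ?_⟩
    have h1 := hKK₀.trans (hlong (t - t₀) (by linarith [ht₀.1, ht.2]))
    have h2 := abs_sub_le (Ihat t) K (Ihat t₀)
    have h3 := abs_sub_le K K₀ (Ihat t₀)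
    rw [abs_sub_comm K₀] at h3
    have h4 : 0 < C₄ * T * ε ^ (n + 1) := by positivity
    linarith
  · obtain ⟨-, hIa, K, -, -, hcorr, -, hphase⟩ := hIhat t ht hti
    have hJconst : ∀ u ∈ Icc t₀ L, J u = Ihat t₀ := fun u hu => by
      have h1 := norm_image_sub_le_of_norm_deriv_le_segment' (fun s hs => (hsol s hs).1)
        (C := 0) (fun s _ => by simp) u hu
      rw [zero_mul] at h1
      rw [← hJt₀]
      exact sub_eq_zero.1 (norm_le_zero_iff.1 h1)
    have h1 := hphase ψ _ (C₄ * ε ^ (n + 1)) (fun u hu => (hsol u hu).2) (fun u hu K' hK' => by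
      have h2 := hK'.trans (hlong (L - t₀) (by linarith [ht₀.1]))
      have h3 := abs_sub_le (Ihat t₀) K₀ K'
      rw [abs_sub_comm K₀ K'] at h3
      have h5 : a / 8 ≤ K' := by
        have := abs_le.1 (h2.trans hsmall)
        linarith
      rw [hJconst u hu, H.deriv_sumH hd hd0 (by linarith)]
      refine (hfreq ε he₄ (ε * u) (hmem' u ⟨ht₀.1.trans hu.1, hu.2⟩) (Ihat t₀) K' (by linarith)
        h5).trans ?_
      rw [hC₄, mul_assoc]
      gcongr
      linarith)
    rw [H.improvedPhase_eq hd hd0 (by linarith)] at hψt₀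
    rw [H.improvedPhase_eq hd hd0 (by linarith)]
    have ht' : 0 ≤ t - t₀ := sub_nonneg.2 ht.1
    have h2 : (C₁ * ε ^ (n + k + 2) + C₄ * ε ^ (n + 1)) * (t - t₀)
        ≤ (C₁ * T + C₄ * T) * (ε ^ (n + 1) / ε ^ k) := by
      have h3 := hlong (t - t₀) (by linarith [ht₀.1, ht.2])
      have h4 : C₄ * ε ^ (n + 1) * (t - t₀) ≤ C₄ * ε ^ (n + 1) * (T / ε ^ k) := by
        gcongr
        linarith [ht₀.1, ht.2]
      have h5 : C₁ * T * ε ^ (n + 1) ≤ C₁ * T * (ε ^ (n + 1) / ε ^ k) := by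
        gcongr
        exact le_div_self hεn.le hεk (pow_le_one₀ hε0.le he₃.le)
      have h6 : C₄ * ε ^ (n + 1) * (T / ε ^ k) = C₄ * T * (ε ^ (n + 1) / ε ^ k) := by ring
      linarith
    have h7 : 2 * C₂ * ε ^ (n + 1) ≤ 2 * C₂ * (ε ^ (n + 1) / ε ^ k) := by
      gcongr
      exact le_div_self hεn.le hεk (pow_le_one₀ hε0.le he₃.le)
    rw [zpow_sub₀ hε0.ne', zpow_natCast, zpow_natCast]
    have h8 := abs_le.1 (h1.trans h2)
    have h9 := abs_le.1 hcorr
    have h10 := abs_le.1 hcorr₀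
    rw [abs_le]
    constructor <;> linarith [h8.1, h8.2, h9.1, h9.2, h10.1, h10.2]
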